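/- Let $M$ be a smooth finite-dimensional (Hausdorff) manifold with a smooth linear connection $\nabla$ on $TM$, with torsion $T(X,Y)=\nabla_XY-\nabla_YX-[X,Y]$ and curvature $R(X,Y)=[\nabla_X,\nabla_Y]-\nabla_{[X,Y]}$. Let $I\subseteq\mathbb R$ be an interval with more than one point, $\gamma_0:I\to M$ a geodesic of $\nabla$, and $Z$ a smooth vector field along $\gamma_0$. Denote by $\tau:TM\to M$ the projection, by $\omega_M$ the canonical involution of $T(TM)$ (in charts $(x,y;z,w)\mapsto(x,z;y,w)$), and by $H\subseteq T(TM)$ the horizontal subbundle of $\nabla$. Put $\beta_0=\dot\gamma_0:I\to TM$ and $X_t=\omega_M(\dot Z(t))$. Then $\beta_0$ is tangent to $H$, $X$ is a vector field along $\beta_0$, and $$\nabla_{\dot\gamma_0}^2Z+\nabla_{\dot\gamma_0}\big(T(Z,\dot\gamma_0)\big)+R(Z,\dot\gamma_0)\dot\gamma_0=0\ \text{ on } I\quad\Longleftrightarrow\quad (\mathcal D X)_t=0\ \text{ for all } t\in I .$$ Here $\mathcal D$ is computed with any smooth subbundle $K$ of $T(TM)$ supplementary to $H$ (the equivalence holds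 for each such $K$): $$(\mathcal D X)_t=\big[\nabla^{\beta_0^*K}_{\partial/\partial t}(P X)\big]_t \bmod H_{\beta_0(t)}\;-\;C^H_{\beta_0(t)}\big((X_t-PX_t)\wedge\dot\beta_0(t)\big)\in T_{\beta_0(t)}(TM)/H_{\beta_0(t)},$$ where $P$ is the projection onto $K$ along $H$, regarded also as a map $T(TM)\to T(TM)$; $C^H(u\wedge v)=[U,V]\bmod H$ for local sections $U,V$ of $H$ extending $u,v\in H_Y$, $Y\in TM$, is the curvature tensor of the subbundle $H$; and $\nabla^{\beta_0^*K}$ is the canonical linear connection on $\beta_0^*K$: for a section $\sigma$ of $\beta_0^*K$, $\nabla^{\beta_0^*K}_{\partial/\partial t}\sigma$ is the vector that corresponds to the vertical vector $\omega_{TM}\big(TP(\omega_{TM}(\dot\sigma(t)))\big)$ at $\sigma(t)$, with $\omega_{TM}$ the canonical involution of $T(T(TM))$. -/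

import Mathlib

open Bundle Set FiberBundle
open scoped Manifold ContDiff Topology

namespace TangentPaths

noncomputable section

/-! ## Subbundles of the tangent bundle of a manifold `N`, and paths tangent to them -/

section Subbundle

variable {F : Type*} [NormedAddCommGroup F] [NormedSpace ℝ F] {H : Type*} [TopologicalSpace H]
  (I : ModelWithCorners ℝ F H) {N : Type*} [TopologicalSpace N] [ChartedSpace H N]

/-- The velocity `ċ(t) ∈ T_{c(t)}N` of a curve `c : s → N` (a one-sided derivative at an end point
of the interval `s`). -/
def velocityAt (c : ℝ → N) (s : Set ℝ) (t : ℝ) : TangentSpace I (c t) :=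
  mfderivWithin 𝓘(ℝ, ℝ) I c s t (1 : ℝ)

/-- The velocity as a point of the total space: the curve `ċ : s → TN`. -/
def velocity (c : ℝ → N) (s : Set ℝ) (t : ℝ) : TangentBundle I N :=
  ⟨c t, velocityAt I c s t⟩

variable [IsManifold I ∞ N]

/-- The canonical involution `ω_N` of `T(TN)`. An element of `T(TN)` is a pair `A = ⟨⟨p, y⟩, (z, w)⟩`
where `y, z, w` are the components in the preferred chart of `N` at `p`: the preferred charts of `TN`
at `⟨p, y⟩` and at `⟨p, z⟩` are one and the same, namely the one induced by the preferred chart of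
`N` at `p`. In every chart of `N` the involution is `(x, y; z, w) ↦ (x, z; y, w)`. -/
def canonicalFlip (A : TangentBundle I.tangent (TangentBundle I N)) :
    TangentBundle I.tangent (TangentBundle I N) :=
  ⟨⟨A.proj.proj, A.snd.1⟩, (A.proj.snd, A.snd.2)⟩

/-- In the preferred chart at `p`, a point `⟨p, v⟩` of the fibre over `p` has the components `v`. -/
theorem extChartAt_fiber (p : N) (y v : TangentSpace I p) :
    extChartAt I.tangent (⟨p, y⟩ : TangentBundle I N) (⟨p, v⟩ : TangentBundle I N) =
      (extChartAt I p p, v) := by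
  refine Prod.ext (by simp) ?_
  exact tangentCoordChange_self (I := I) (x := p) (z := p) (v := v) (mem_extChartAt_source p)

/-- The derivative of the inclusion `T_pN → TN` at `y` is `v ↦ (0, v)`. -/
theorem hasMFDerivAt_fiber (p : N) (y : F) :
    HasMFDerivAt 𝓘(ℝ, F) I.tangent
      (fun v : F => (⟨p, (v : TangentSpace I p)⟩ : TangentBundle I N)) y
      (ContinuousLinearMap.inr ℝ F F) := by
  refine ⟨(FiberBundle.totalSpaceMk_isInducing F
    (TangentSpace I : N → Type _) p).continuous.continuousAt, ?_⟩
  have : writtenInExtChartAt 𝓘(ℝ, F) I.tangent y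
      (fun v : F => (⟨p, (v : TangentSpace I p)⟩ : TangentBundle I N)) =
      fun v : F => (extChartAt I p p, v) := by
    ext1 v
    exact extChartAt_fiber I p y v
  rw [this]
  exact (hasFDerivAt_prodMk_right _ _).hasFDerivWithinAt

/-- The vertical component of `A = ⟨⟨p, y⟩, (z, w)⟩ ∈ T_{⟨p, y⟩}(TN)` in the preferred chart at `p`.
For a vertical `A`, i.e. `z = 0`, this is the vector `v ∈ T_pN` such that
`A = d/dr ⟨p, y + r v⟩` at `r = 0` (see `hasMFDerivAt_fiber`). -/
def verticalPart (Y : TangentBundle I N) :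
    TangentSpace I.tangent Y →L[ℝ] TangentSpace I Y.proj :=
  ContinuousLinearMap.snd ℝ F F

/-- `S ⊕ K = TN` for two families of subspaces of the tangent spaces, with smooth projection onto `K`
along `S`, seen as a map `TN → TN`. (Two supplementary smooth subbundles `S`, `K` have this property,
and conversely the kernels and the images of a smooth field of projections form smooth subbundles;
so for a smooth subbundle `S` this says that `K` is a smooth subbundle supplementary to `S`.) -/
structure IsSmoothComplement (S K : Π p : N, Submodule ℝ (TangentSpace I p)) : Prop where
  isCompl : ∀ p, IsCompl (K p) (S p)
  contMDiff : ContMDiff I.tangent I.tangent ∞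
    (fun Y : TangentBundle I N =>
      (⟨Y.proj, (K Y.proj).projection (S Y.proj) (isCompl Y.proj) Y.snd⟩ : TangentBundle I N))

namespace IsSmoothComplement

variable {I} {S K : Π p : N, Submodule ℝ (TangentSpace I p)}

/-- The projection `P_p : T_pN → T_pN` onto `K p` along `S p`. -/
def projAt (h : IsSmoothComplement I S K) (p : N) : TangentSpace I p →ₗ[ℝ] TangentSpace I p :=
  (K p).projection (S p) (h.isCompl p)

/-- The projection onto `K` along `S`, as a map `P : TN → TN`. -/
def proj (h : IsSmoothComplement I S K) (Y : TangentBundle I N) : TangentBundle I N :=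
  ⟨Y.proj, h.projAt Y.proj Y.snd⟩

/-- The covariant derivative `∇σ` of the canonical linear connection on `β^*K → s`, along a path
`β : s → N` tangent to `S`: for a field `σ` of vectors of `K` along `β` (so that `β` is the curve of
the base points of `σ`) it is the vector of `T_{β(t)}N` that corresponds to the vertical vector
`(ω ∘ TP ∘ ω) σ̇(t) ∈ T_{σ(t)}(T_{β(t)}N)`. -/
def covDeriv (h : IsSmoothComplement I S K) (σ : ℝ → TangentBundle I N) (s : Set ℝ) (t : ℝ) :
    TangentSpace I (σ t).proj :=
  verticalPart I _
    (canonicalFlip I (tangentMap I.tangent I.tangent h.proj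
      (canonicalFlip I (velocity I.tangent σ s t)))).snd

end IsSmoothComplement

/-- A vector field `X` on `N` with values in `S` that is smooth near `p` and has `X_p = u`
(for `u ∈ S p`). -/
def sectionThrough (S : Π p : N, Submodule ℝ (TangentSpace I p)) (p : N) (u : TangentSpace I p) :
    Π q : N, TangentSpace I q :=
  Classical.epsilon fun X : Π q : N, TangentSpace I q =>
    ContMDiffAt I I.tangent ∞ (fun q => (⟨q, X q⟩ : TangentBundle I N)) p ∧
      (∀ q, X q ∈ S q) ∧ X p = u

/-- The curvature tensor of the subbundle `S ⊆ TN` at `p`: for `u, v ∈ S p`,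
`C_p(u ∧ v) = [X, Y]_p mod S p`, where `X, Y` are arbitrary smooth local sections of `S` with
`X_p = u` and `Y_p = v`. (The class does not depend on these sections.) -/
def curvature (S : Π p : N, Submodule ℝ (TangentSpace I p)) (p : N) (u v : TangentSpace I p) :
    TangentSpace I p ⧸ S p :=
  (S p).mkQ (VectorField.mlieBracket I (sectionThrough I S p u) (sectionThrough I S p v) p)

/-- The operator `D` of the infinitesimal variation of paths tangent to `S`. Let `X` be a vector field
along a path `β` tangent to `S` (`β(t)` is the base point of `X t`). Then
`(D X)_t = ∇^{TN/S} (X mod S) - C_{β(t)}((X_t - P X_t) ∧ β̇(t))`,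
where `K` is supplementary to `S`, `P` is the projection onto `K` along `S`, and `∇^{TN/S}` is the
covariant derivative on `β^*(TN/S)` that corresponds to the canonical one on `β^*K` under the
isomorphism `K ≃ TN/S`. -/
def operatorD {S K : Π p : N, Submodule ℝ (TangentSpace I p)} (h : IsSmoothComplement I S K)
    (X : ℝ → TangentBundle I N) (s : Set ℝ) (t : ℝ) :
    TangentSpace I (X t).proj ⧸ S (X t).proj :=
  (S (X t).proj).mkQ (h.covDeriv (fun r => h.proj (X r)) s t) -
    curvature I S (X t).proj ((X t).snd - h.projAt (X t).proj (X t).snd)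
      (velocityAt I (fun r => (X r).proj) s t)

end Subbundle

/-! ## Linear connections on the tangent bundle of a manifold `M` -/

section Connection

variable {E : Type*} [NormedAddCommGroup E] [NormedSpace ℝ E] {H : Type*} [TopologicalSpace H]
  {I : ModelWithCorners ℝ E H} {M : Type*} [TopologicalSpace M] [ChartedSpace H M]
  [IsManifold I ∞ M]
  (cov : CovariantDerivative I E (TangentSpace I : M → Type _))

/-- The vertical projection `V_Y : T_Y(TM) → T_Y(T_pM) ≃ T_pM` of a linear connection, `Y ∈ T_pM`.
It is the identity on vertical vectors and maps `T_pσ · v` to `∇_v σ` for every field `σ` with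
`σ(p) = Y`; so `V_Y(A) = (A - T_pσ(Tτ A)) + ∇_{Tτ A} σ` with `τ : TM → M` the projection and any such
`σ`, for which we take the field that is constant in the preferred chart at `p`. -/
def connector (Y : TangentBundle I M) : TangentSpace I.tangent Y →L[ℝ] TangentSpace I Y.proj :=
  let σ : Π q : M, TangentSpace I q := extend E Y.snd
  let dτ : TangentSpace I.tangent Y →L[ℝ] TangentSpace I Y.proj :=
    mfderiv I.tangent I (fun Z : TangentBundle I M => Z.proj) Y
  let dσ : TangentSpace I Y.proj →L[ℝ] TangentSpace I.tangent Y :=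
    mfderiv I I.tangent (fun q => (⟨q, σ q⟩ : TangentBundle I M)) Y.proj
  verticalPart I Y ∘L (ContinuousLinearMap.id ℝ _ - dσ ∘L dτ) + cov σ Y.proj ∘L dτ

/-- The horizontal subbundle of `T(TM)` of a linear connection: the kernel of the vertical
projection. -/
def horizontal (Y : TangentBundle I M) : Submodule ℝ (TangentSpace I.tangent Y) :=
  LinearMap.ker (connector cov Y).toLinearMap

/-- The covariant derivative `∇_{γ̇(t)} Z` of a vector field `Z` along a curve `γ : s → M`:
the vertical part of `Ż(t)`. -/
def covAlong (γ : ℝ → M) (s : Set ℝ) (Z : Π t : ℝ, TangentSpace I (γ t)) (t : ℝ) :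
    TangentSpace I (γ t) :=
  connector cov ⟨γ t, Z t⟩
    (velocityAt I.tangent (fun r => (⟨γ r, Z r⟩ : TangentBundle I M)) s t)

/-- A geodesic `γ : s → M`: a smooth curve with `∇_{γ̇} γ̇ = 0`. -/
def IsGeodesicOn (γ : ℝ → M) (s : Set ℝ) : Prop :=
  ContMDiffOn 𝓘(ℝ, ℝ) I ∞ γ s ∧ ∀ t ∈ s, covAlong cov γ s (velocityAt I γ s) t = 0

/-- The curvature tensor `R(u, v) w = ∇_U ∇_V W - ∇_V ∇_U W - ∇_{[U, V]} W` of a linear connection,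
where `U, V, W` are vector fields that extend `u, v, w ∈ T_pM` smoothly near `p`; we take those that
are constant in the preferred chart at `p`. -/
def riemann (p : M) (u v w : TangentSpace I p) : TangentSpace I p :=
  let U : Π q : M, TangentSpace I q := extend E u
  let V : Π q : M, TangentSpace I q := extend E v
  let W : Π q : M, TangentSpace I q := extend E w
  cov (fun q => cov W q (V q)) p u - cov (fun q => cov W q (U q)) p v -
    cov W p (VectorField.mlieBracket I U V p)

/-- `Z` solves the Jacobi equation with torsion along `γ`:
`∇²Z + ∇(T(Z, γ̇)) + R(Z, γ̇) γ̇ = 0`. -/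
def IsJacobiOn [FiniteDimensional ℝ E] [CompleteSpace E]
    (γ : ℝ → M) (s : Set ℝ) (Z : Π t : ℝ, TangentSpace I (γ t)) : Prop :=
  ∀ t ∈ s, covAlong cov γ s (covAlong cov γ s Z) t +
    covAlong cov γ s (fun r => cov.torsion (γ r) (Z r) (velocityAt I γ s r)) t +
    riemann cov (γ t) (Z t) (velocityAt I γ s t) (velocityAt I γ s t) = 0

end Connection

end

end TangentPaths

/-! Both sides are the linearization of the geodesic equation. Fix `t`, work in the preferred chart
at `γ t`, and write `x`, `z` for the components of the curve and of the field, `Γ(y)v` for the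
components of the covariant derivative along `v` of the field with constant components `y`.

Suppose a subbundle `S` is, near a point and in a chart, the kernel of a differentiable family of
linear maps `α(a)`. A path `b` is tangent to `S` when `α(b)b' = 0`, and linearizing this in the
direction `ξ` gives `Dα(b)[ξ]b' + α(b)ξ'`. `IsSmoothComplement.operatorD_eq_zero_iff` shows that,
along a path tangent to `S`, the operator `D` vanishes at `t` exactly when this expression does. The
complement `K` drops out: the terms in the projection `P` coming from the canonical connection on
`b^*K` cancel against those of the curvature of `S`. The cancellation needs only that `α(Pv) =
α(v)`, since `v - Pv` lies in `S`.

For the horizontal bundle, `α(x, y)(u, w) = w + Γ(x)(y)u` (`connectorRep`). The path `b` is `(x,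
x')`, and the flipped velocity of the field is `(z, z')`, so `D` vanishes iff `z'' + DΓ[z](x')x' +
Γ(z')x' + Γ(x')z' = 0` (`operatorD_canonicalFlip_eq_zero_iff`).

On the other side, expanding the second covariant derivative, the torsion term and the curvature
term gives the same expression plus `Γ(x'' + Γ(x')x')z` (`jacobi_eq`). The extra term vanishes
because the curve is a geodesic.

Velocities and constant fields are defined with the preferred chart at the moving point, while
derivatives are taken in one fixed chart. The Hessians of the chart changes that appear disappear
either by cancellation or by the symmetry of second derivatives. -/

namespace TangentPaths

/-! ### Components of tangent vectors and velocities in a preferred chart. -/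

section Coordinates

variable {F : Type*} [NormedAddCommGroup F] [NormedSpace ℝ F] {H : Type*} [TopologicalSpace H]
  {I : ModelWithCorners ℝ F H} {N : Type*} [TopologicalSpace N] [ChartedSpace H N]
  [IsManifold I ∞ N]

variable (I) in
/-- The components of a tangent vector at `q` in the preferred chart at `x₀`. -/
noncomputable def chartDeriv (x₀ q : N) : TangentSpace I q →L[ℝ] F :=
  (tangentCoordChange I q x₀ q : F →L[ℝ] F)

theorem extChartAt_tangent_apply (Y₀ Y : TangentBundle I N) :
    extChartAt I.tangent Y₀ Y = (extChartAt I Y₀.proj Y.proj, chartDeriv I Y₀.proj Y.proj Y.snd) :=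
  rfl

theorem chartDeriv_self (q : N) (v : TangentSpace I q) : chartDeriv I q q v = v :=
  tangentCoordChange_self (I := I) (mem_extChartAt_source q)

theorem hasMFDerivAt_extChartAt' {x₀ q : N} (h : q ∈ (chartAt H x₀).source) :
    HasMFDerivAt I 𝓘(ℝ, F) (extChartAt I x₀) q (chartDeriv I x₀ q) := by
  have := hasMFDerivAt_extChartAt (I := I) h
  rwa [mfderiv_chartAt_eq_tangentCoordChange h] at this

theorem hasFDerivWithinAt_extChartAt_comp {F₂ : Type*} [NormedAddCommGroup F₂] [NormedSpace ℝ F₂]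
    {x₀ : N} {c : F₂ → N} {s : Set F₂} {t : F₂}
    {L : F₂ →L[ℝ] TangentSpace I (c t)} (hc : HasMFDerivWithinAt 𝓘(ℝ, F₂) I c s t L)
    (h : c t ∈ (chartAt H x₀).source) :
    HasFDerivWithinAt (fun r => extChartAt I x₀ (c r)) (chartDeriv I x₀ (c t) ∘L L) s t :=
  ((hasMFDerivAt_extChartAt' h).comp_hasMFDerivWithinAt t hc).hasFDerivWithinAt

theorem hasDerivWithinAt_extChartAt_comp {x₀ : N} {c : ℝ → N} {s : Set ℝ} {t : ℝ}
    (hc : MDifferentiableWithinAt 𝓘(ℝ, ℝ) I c s t) (h : c t ∈ (chartAt H x₀).source) :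
    HasDerivWithinAt (fun r => extChartAt I x₀ (c r))
      (chartDeriv I x₀ (c t) (velocityAt I c s t)) s t :=
  (hasFDerivWithinAt_extChartAt_comp hc.hasMFDerivWithinAt h).hasDerivWithinAt

theorem chartDeriv_bijective {x₀ q : N} (h : q ∈ (chartAt H x₀).source) :
    Function.Bijective (chartDeriv I x₀ q) := by
  have h1 := isInvertible_mfderiv_extChartAt (I := I) (x := x₀) (y := q) (by simpa using h)
  rw [(hasMFDerivAt_extChartAt' h).mfderiv] at h1
  exact h1.bijective

theorem hasFDerivAt_extChartAt_symm_chart [I.Boundaryless] {x₀ q : N}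
    (h : q ∈ (chartAt H x₀).source) :
    HasFDerivAt (fun a => extChartAt I x₀ ((extChartAt I q).symm a)) (chartDeriv I x₀ q)
      (extChartAt I q q) := by
  have := hasFDerivWithinAt_tangentCoordChange (I := I) (x := q) (y := x₀) (z := q) (by simp [h])
  rw [I.range_eq_univ, hasFDerivWithinAt_univ] at this
  exact this

end Coordinates

/-! ### Differentiability read in charts; vector fields and Lie brackets in components. -/

section Coordinates

variable {F : Type*} [NormedAddCommGroup F] [NormedSpace ℝ F] {H : Type*} [TopologicalSpace H]
  {I : ModelWithCorners ℝ F H} {N : Type*} [TopologicalSpace N] [ChartedSpace H N]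
  [IsManifold I ∞ N]

theorem mdifferentiableAt_extChartAt_symm [I.Boundaryless] {x₀ : N} {a : F}
    (h : a ∈ (extChartAt I x₀).target) :
    MDifferentiableAt 𝓘(ℝ, F) I (extChartAt I x₀).symm a := by
  have := mdifferentiableWithinAt_extChartAt_symm (I := I) h
  rwa [I.range_eq_univ, mdifferentiableWithinAt_univ] at this

/-- Composing the coordinate expression with the inverse chart recovers the map. Continuity need not
be assumed separately, because the map stays in the chart domain. -/
theorem mdifferentiableWithinAt_of_extChartAt_comp [I.Boundaryless] {F₂ : Type*}
    [NormedAddCommGroup F₂] [NormedSpace ℝ F₂] {x₀ : N} {c : F₂ → N} {s : Set F₂} {t : F₂}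
    (ht : t ∈ s) (h : ∀ᶠ r in 𝓝[s] t, c r ∈ (chartAt H x₀).source)
    (hc : DifferentiableWithinAt ℝ (fun r => extChartAt I x₀ (c r)) s t) :
    MDifferentiableWithinAt 𝓘(ℝ, F₂) I c s t := by
  have ht' := h.self_of_nhdsWithin ht
  have h1 := (mdifferentiableAt_extChartAt_symm (I := I) (x₀ := x₀) (a := extChartAt I x₀ (c t))
    ((extChartAt I x₀).map_source (by simpa using ht'))).comp_mdifferentiableWithinAt t
      hc.mdifferentiableWithinAt
  refine h1.congr_of_eventuallyEq ?_ ?_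
  · filter_upwards [h] with r hr
    exact ((extChartAt I x₀).left_inv (by simpa using hr)).symm
  · exact ((extChartAt I x₀).left_inv (by simpa using ht')).symm

theorem mdifferentiableAt_of_extChartAt_comp_symm [I.Boundaryless] {H' : Type*}
    [TopologicalSpace H']
    {F' : Type*} [NormedAddCommGroup F'] [NormedSpace ℝ F'] {J : ModelWithCorners ℝ F' H'}
    [J.Boundaryless] {N' : Type*} [TopologicalSpace N'] [ChartedSpace H' N'] [IsManifold J ∞ N']
    {x₀ q : N} {y₀ : N'} {f : N → N'} (hq : q ∈ (chartAt H x₀).source)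
    (h : ∀ᶠ r in 𝓝 q, f r ∈ (chartAt H' y₀).source)
    (hf : DifferentiableAt ℝ (fun a => extChartAt J y₀ (f ((extChartAt I x₀).symm a)))
      (extChartAt I x₀ q)) :
    MDifferentiableAt I J f q := by
  have hφ := (hasMFDerivAt_extChartAt' (I := I) hq).mdifferentiableAt
  have h1 := (mdifferentiableAt_extChartAt_symm (I := J) (x₀ := y₀) (a := extChartAt J y₀ (f q))
    ((extChartAt J y₀).map_source (by simpa using h.self_of_nhds)))
  have hl : (extChartAt I x₀).symm (extChartAt I x₀ q) = q :=
    (extChartAt I x₀).left_inv (by simpa using hq)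
  have h2 := hf.mdifferentiableAt.comp q hφ
  have h3 := h1.comp_of_eq (x := q) h2 (by simp only [Function.comp_apply, hl])
  refine h3.congr_of_eventuallyEq ?_
  filter_upwards [h, (chartAt H x₀).open_source.mem_nhds hq] with r hr hr'
  have : (extChartAt I x₀).symm (extChartAt I x₀ r) = r :=
    (extChartAt I x₀).left_inv (by simpa using hr')
  simp only [Function.comp_apply, this]
  exact ((extChartAt J y₀).left_inv (by simpa using hr)).symm

variable (I) in
/-- The components of a vector field in the preferred chart at `x₀`, as a function of the
coordinates. -/
noncomputable def sectionRep (x₀ : N) (V : Π q : N, TangentSpace I q) (a : F) : F :=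
  chartDeriv I x₀ ((extChartAt I x₀).symm a) (V ((extChartAt I x₀).symm a))

theorem sectionRep_apply {x₀ q : N} (h : q ∈ (chartAt H x₀).source)
    (V : Π q : N, TangentSpace I q) :
    sectionRep I x₀ V (extChartAt I x₀ q) = chartDeriv I x₀ q (V q) := by
  have hl : (extChartAt I x₀).symm (extChartAt I x₀ q) = q :=
    (extChartAt I x₀).left_inv (by simpa using h)
  rw [sectionRep, hl]

theorem differentiableAt_sectionRep [I.Boundaryless] {x₀ q : N} (h : q ∈ (chartAt H x₀).source)
    {V : Π q : N, TangentSpace I q}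
    (hV : MDifferentiableAt I I.tangent (fun q => (⟨q, V q⟩ : TangentBundle I N)) q) :
    DifferentiableAt ℝ (sectionRep I x₀ V) (extChartAt I x₀ q) := by
  have hl : (extChartAt I x₀).symm (extChartAt I x₀ q) = q :=
    (extChartAt I x₀).left_inv (by simpa using h)
  have hs := mdifferentiableAt_extChartAt_symm (I := I) (x₀ := x₀) (a := extChartAt I x₀ q)
    ((extChartAt I x₀).map_source (by simpa using h))
  have h1 := MDifferentiableAt.comp_of_eq (x := extChartAt I x₀ q) hV hs hl
  have h2 := hasMFDerivAt_extChartAt' (I := I.tangent) (x₀ := (⟨x₀, 0⟩ : TangentBundle I N))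
    (q := ⟨q, V q⟩) (by rw [TangentBundle.mem_chart_source_iff]; exact h)
  have h3 := MDifferentiableAt.comp_of_eq (x := extChartAt I x₀ q) h2.mdifferentiableAt h1
    (by simp only [Function.comp_apply]; rw [hl])
  exact h3.differentiableAt.snd

/-- The bracket is defined by pulling back along the inverse chart; pulled back, the fields become
their component functions. At the centre of its own preferred chart the derivative of the chart is
the identity, so no conjugation remains. -/
theorem mlieBracket_eq_fderiv [I.Boundaryless] {p : N} (V W : Π q : N, TangentSpace I q) :
    VectorField.mlieBracket I V W p =
      (fderiv ℝ (sectionRep I p W) (extChartAt I p p) (V p) -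
        fderiv ℝ (sectionRep I p V) (extChartAt I p p) (W p) : F) := by
  have key : ∀ V : Π q : N, TangentSpace I q,
      VectorField.mpullbackWithin 𝓘(ℝ, F) I (extChartAt I p).symm V (range I)
        =ᶠ[𝓝 (extChartAt I p p)] sectionRep I p V := by
    intro V
    filter_upwards [extChartAt_target_mem_nhds (I := I) p] with a ha
    have h1 := mfderivWithin_extChartAt_symm_comp_mfderiv_extChartAt ha
    have h2 := mfderiv_extChartAt_comp_mfderivWithin_extChartAt_symm ha
    have h3 : (extChartAt I p).symm a ∈ (chartAt H p).source := by
      simpa using (extChartAt I p).map_target ha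
    rw [VectorField.mpullbackWithin_apply, ContinuousLinearMap.inverse_eq h1 h2,
      (hasMFDerivAt_extChartAt' h3).mfderiv]
    rfl
  have hinv : ∀ w : F, (mfderiv I 𝓘(ℝ, F) (extChartAt I p) p).inverse w = w := by
    intro w
    obtain ⟨e, he⟩ := isInvertible_mfderiv_extChartAt (I := I) (mem_extChartAt_source p)
    have h1 : ∀ v, e v = v := fun v => by
      have : (e : TangentSpace I p →L[ℝ] TangentSpace 𝓘(ℝ, F) (extChartAt I p p)) v = v := by
        rw [he, (hasMFDerivAt_extChartAt' (mem_chart_source H p)).mfderiv]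
        exact chartDeriv_self p v
      exact this
    rw [← he, ContinuousLinearMap.inverse_equiv]
    exact (e.symm_apply_eq).2 (h1 w).symm
  have h0 : ((extChartAt I p).symm ⁻¹' univ ∩ range I) = univ := by simp [I.range_eq_univ]
  have hx : ∀ V, sectionRep I p V (extChartAt I p p) = V p := fun V => by
    rw [sectionRep_apply (mem_chart_source H p), chartDeriv_self]
  have e := Filter.EventuallyEq.lieBracket_vectorField_eq (𝕜 := ℝ) (key V) (key W)
  have e₂ := VectorField.lieBracketWithin_univ (𝕜 := ℝ)
    (V := VectorField.mpullbackWithin 𝓘(ℝ, F) I (extChartAt I p).symm V (range I))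
    (W := VectorField.mpullbackWithin 𝓘(ℝ, F) I (extChartAt I p).symm W (range I))
  rw [← h0] at e₂
  refine (hinv _).trans ((congrFun e₂ _).trans (e.trans ?_))
  rw [VectorField.lieBracket, hx, hx]

end Coordinates

/-! ### Subbundles as kernels: curvature, projections and the operator `D` in a chart. -/

section Coordinates

variable {F : Type*} [NormedAddCommGroup F] [NormedSpace ℝ F] {H : Type*} [TopologicalSpace H]
  {I : ModelWithCorners ℝ F H} {N : Type*} [TopologicalSpace N] [ChartedSpace H N]
  [IsManifold I ∞ N] {S K : Π p : N, Submodule ℝ (TangentSpace I p)}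

theorem IsSmoothComplement.sub_projAt_mem (h : IsSmoothComplement I S K) (p : N)
    (v : TangentSpace I p) : v - h.projAt p v ∈ S p := by
  have := Submodule.projection_add_projection_eq_self (h.isCompl p) v
  exact (sub_eq_of_eq_add' this.symm) ▸ Submodule.projection_apply_mem (h.isCompl p).symm v

theorem IsSmoothComplement.projAt_eq_zero (h : IsSmoothComplement I S K) {p : N}
    {v : TangentSpace I p} (hv : v ∈ S p) : h.projAt p v = 0 :=
  (Submodule.projection_apply_eq_zero_iff (h.isCompl p)).2 hv

theorem IsSmoothComplement.sectionThrough_spec (h : IsSmoothComplement I S K) {p : N}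
    {u : TangentSpace I p} (hu : u ∈ S p) :
    ContMDiffAt I I.tangent ∞ (fun q => (⟨q, sectionThrough I S p u q⟩ : TangentBundle I N)) p ∧
      (∀ q, sectionThrough I S p u q ∈ S q) ∧ sectionThrough I S p u p = u := by
  -- A complement of `S` is what guarantees that sections through `u` exist, so that the choice in
  -- `sectionThrough` is not arbitrary: subtract from a local extension of `u` its projection to
  -- `K`.
  refine Classical.epsilon_spec (p := fun X : Π q : N, TangentSpace I q =>
    ContMDiffAt I I.tangent ∞ (fun q => (⟨q, X q⟩ : TangentBundle I N)) p ∧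
      (∀ q, X q ∈ S q) ∧ X p = u) ⟨fun q => extend F u q - h.projAt q (extend F u q), ?_,
      fun q => h.sub_projAt_mem q _, ?_⟩
  · have h1 : ContMDiffAt I I.tangent ∞ (fun q => (⟨q, extend F u q⟩ : TangentBundle I N)) p :=
      contMDiffAt_extend I F u
    exact h1.sub_section (h.contMDiff.contMDiffAt.comp p h1)
  · simp only [extend_apply_self, h.projAt_eq_zero hu, sub_zero]

variable [I.Boundaryless] {F' : Type*} [NormedAddCommGroup F'] [NormedSpace ℝ F']

omit [IsManifold I ∞ N] [I.Boundaryless] in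
theorem eventually_extChartAt_symm {x₀ : N} {P : N → Prop} (h : ∀ᶠ q in 𝓝 x₀, P q) :
    ∀ᶠ a in 𝓝 (extChartAt I x₀ x₀), P ((extChartAt I x₀).symm a) := by
  have := continuousAt_extChartAt_symm (I := I) x₀
  rw [ContinuousAt, extChartAt_to_inv] at this
  exact this h

/-- Product rule applied to `α(U) = 0`. -/
theorem apply_fderiv_sectionRep_of_mem {p : N} {α : F → F →L[ℝ] F'}
    (hα : DifferentiableAt ℝ α (extChartAt I p p))
    (hS : ∀ᶠ q in 𝓝 p, ∀ v : TangentSpace I q,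
      v ∈ S q ↔ α (extChartAt I p q) (chartDeriv I p q v) = 0)
    {U : Π q : N, TangentSpace I q}
    (hU : MDifferentiableAt I I.tangent (fun q => (⟨q, U q⟩ : TangentBundle I N)) p)
    (hUS : ∀ q, U q ∈ S q) (w : F) :
    α (extChartAt I p p) (fderiv ℝ (sectionRep I p U) (extChartAt I p p) w) =
      - fderiv ℝ α (extChartAt I p p) w (U p) := by
  have h1 := hα.hasFDerivAt.clm_apply
    (differentiableAt_sectionRep (mem_chart_source H p) hU).hasFDerivAt
  have h2 : (fun a => α a (sectionRep I p U a)) =ᶠ[𝓝 (extChartAt I p p)] fun _ => 0 := by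
    filter_upwards [eventually_extChartAt_symm (I := I) hS, extChartAt_target_mem_nhds (I := I) p]
      with a ha hat
    have := (ha (U _)).1 (hUS _)
    rwa [(extChartAt I p).right_inv hat] at this
  have h3 := (h1.congr_of_eventuallyEq h2.symm).unique (hasFDerivAt_const (0 : F') _)
  have h4 := DFunLike.congr_fun h3 w
  rw [sectionRep_apply (mem_chart_source H p), chartDeriv_self] at h4
  exact eq_neg_of_add_eq_zero_left h4

/-- In components `[U, V] = DV[u] - DU[v]`; applying `α` moves each derivative from the sections to
`α`. The result depends only on `u` and `v`, which takes care of the chosen extensions. -/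
theorem IsSmoothComplement.exists_curvature_eq (h : IsSmoothComplement I S K) {p : N}
    {α : F → F →L[ℝ] F'} (hα : DifferentiableAt ℝ α (extChartAt I p p))
    (hS : ∀ᶠ q in 𝓝 p, ∀ v : TangentSpace I q,
      v ∈ S q ↔ α (extChartAt I p q) (chartDeriv I p q v) = 0)
    {u v : TangentSpace I p} (hu : u ∈ S p) (hv : v ∈ S p) :
    ∃ b : TangentSpace I p, curvature I S p u v = (S p).mkQ b ∧
      α (extChartAt I p p) b =
        fderiv ℝ α (extChartAt I p p) v u - fderiv ℝ α (extChartAt I p p) u v := by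
  refine ⟨_, rfl, ?_⟩
  obtain ⟨hU, hUS, hUp⟩ := h.sectionThrough_spec hu
  obtain ⟨hV, hVS, hVp⟩ := h.sectionThrough_spec hv
  have e₁ := apply_fderiv_sectionRep_of_mem hα hS (hV.mdifferentiableAt (by simp)) hVS u
  have e₂ := apply_fderiv_sectionRep_of_mem hα hS (hU.mdifferentiableAt (by simp)) hUS v
  rw [hVp] at e₁
  rw [hUp] at e₂
  rw [mlieBracket_eq_fderiv, hUp, hVp, map_sub]
  exact (congrArg₂ (· - ·) e₁ e₂).trans (neg_sub_neg _ _)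

/-- The components of `P Y` for a map `P : TN → TN` over the identity, in the preferred chart. -/
theorem IsSmoothComplement.hasFDerivAt_proj (h : IsSmoothComplement I S K) (Y : TangentBundle I N) :
    HasFDerivAt (fun A : F × F =>
        (extChartAt I.tangent Y (h.proj ((extChartAt I.tangent Y).symm A))).2)
      (ContinuousLinearMap.snd ℝ F F ∘L
        (mfderiv I.tangent I.tangent h.proj Y : F × F →L[ℝ] F × F))
      (extChartAt I.tangent Y Y) := by
  have h1 : HasFDerivWithinAt (writtenInExtChartAt I.tangent I.tangent Y h.proj)
      (mfderiv I.tangent I.tangent h.proj Y : F × F →L[ℝ] F × F) (range I.tangent)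
      (extChartAt I.tangent Y Y) := (h.contMDiff.mdifferentiable (by simp) Y).hasMFDerivAt.2
  rw [ModelWithCorners.range_eq_univ] at h1
  exact (hasFDerivWithinAt_univ.1 h1).snd

/-- Differentiate the identity `α(a)(P(a)y) = α(a)y` at a point where `y` lies in `S`. There `Py =
0`, so the term in which `α` is differentiated against `Py` drops out. -/
theorem IsSmoothComplement.apply_mfderiv_proj (h : IsSmoothComplement I S K)
    {α : F → F →L[ℝ] F'} (p : N) (hα : DifferentiableAt ℝ α (extChartAt I p p))
    (hS : ∀ᶠ q in 𝓝 p, ∀ v : TangentSpace I q,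
      v ∈ S q ↔ α (extChartAt I p q) (chartDeriv I p q v) = 0)
    {y : F} (hy : (y : TangentSpace I p) ∈ S p) (ξ η : F) :
    α (extChartAt I p p)
        (mfderiv I.tangent I.tangent h.proj (⟨p, y⟩ : TangentBundle I N) (ξ, η) : F × F).2 =
      fderiv ℝ α (extChartAt I p p) ξ y + α (extChartAt I p p) η := by
  set Y : TangentBundle I N := ⟨p, y⟩
  have hY : extChartAt I.tangent Y Y = (extChartAt I p p, y) := by
    rw [extChartAt_tangent_apply]
    exact congrArg _ (chartDeriv_self p y)
  have h1 := h.hasFDerivAt_proj Y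
  rw [hY] at h1
  have hα' : HasFDerivAt (fun A : F × F => α A.1)
      (fderiv ℝ α (extChartAt I p p) ∘L ContinuousLinearMap.fst ℝ F F) (extChartAt I p p, y) :=
    HasFDerivAt.comp (𝕜 := ℝ) (f := Prod.fst) (extChartAt I p p, y) hα.hasFDerivAt hasFDerivAt_fst
  have h2 := hα'.clm_apply h1
  have h3 := hα'.clm_apply (hasFDerivAt_snd (𝕜 := ℝ) (p := (extChartAt I p p, y)))
  have h4 : (fun A : F × F => α A.1
      (extChartAt I.tangent Y (h.proj ((extChartAt I.tangent Y).symm A))).2) =ᶠ[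
        𝓝 (extChartAt I p p, y)] fun A => α A.1 A.2 := by
    have hS' : ∀ᶠ Z : TangentBundle I N in 𝓝 Y, ∀ v : TangentSpace I Z.proj,
        v ∈ S Z.proj ↔ α (extChartAt I p Z.proj) (chartDeriv I p Z.proj v) = 0 :=
      ((FiberBundle.continuous_proj F (TangentSpace I)).tendsto Y).eventually hS
    have e1 := eventually_extChartAt_symm (I := I.tangent) hS'
    have e2 := extChartAt_target_mem_nhds (I := I.tangent) Y
    rw [hY] at e1 e2
    filter_upwards [e1, e2] with A hA hAt
    set Z := (extChartAt I.tangent Y).symm A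
    have hZ : extChartAt I.tangent Y Z = A := (extChartAt I.tangent Y).right_inv hAt
    rw [extChartAt_tangent_apply] at hZ
    have h5 := (hA (Z.snd - h.projAt Z.proj Z.snd)).1 (h.sub_projAt_mem _ _)
    rw [map_sub, map_sub, sub_eq_zero] at h5
    rw [extChartAt_tangent_apply, ← hZ]
    exact h5.symm
  have h5 := DFunLike.congr_fun ((h2.congr_of_eventuallyEq h4.symm).unique h3) (ξ, η)
  have hPY : (extChartAt I.tangent Y (h.proj ((extChartAt I.tangent Y).symm
      (extChartAt I p p, y)))).2 = 0 := by
    rw [← hY, extChartAt_to_inv, extChartAt_tangent_apply]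
    have : (h.proj Y).snd = 0 := h.projAt_eq_zero hy
    rw [this]
    exact map_zero _
  simp only [_root_.add_apply, ContinuousLinearMap.comp_apply,
    ContinuousLinearMap.flip_apply, hPY, map_zero, add_zero] at h5
  rw [add_comm]
  exact h5

/-- Write `x` for the vector, `ξ = Px`, `n` for the velocity of the base path, `A.2` for the
derivative of the components of `PX`. The class of the covariant derivative contributes `Dα[ξ]n +
α(A.2)`, and the curvature contributes `Dα[n](x - ξ) - Dα[x - ξ]n`. Differentiating `α(PX) = α(X)`
along the path gives `Dα[n]ξ + α(A.2) = Dα[n]x + α(η)`, which eliminates `ξ` and `A.2` from the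
difference. -/
theorem IsSmoothComplement.operatorD_eq_zero_iff (h : IsSmoothComplement I S K)
    {X : ℝ → TangentBundle I N} {s : Set ℝ} {t : ℝ} (hs : UniqueDiffWithinAt ℝ s t)
    (hX : MDifferentiableWithinAt 𝓘(ℝ, ℝ) I.tangent X s t)
    {α : F → F →L[ℝ] F'} (hα : DifferentiableAt ℝ α (extChartAt I (X t).proj (X t).proj))
    (hS : ∀ᶠ q in 𝓝 (X t).proj, ∀ v : TangentSpace I q,
      v ∈ S q ↔ α (extChartAt I (X t).proj q) (chartDeriv I (X t).proj q v) = 0)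
    (hβ : velocityAt I (fun r => (X r).proj) s t ∈ S (X t).proj) {η : F}
    (hη : HasDerivWithinAt (fun r => chartDeriv I (X t).proj (X r).proj (X r).snd) η s t) :
    operatorD I h X s t = 0 ↔
      fderiv ℝ α (extChartAt I (X t).proj (X t).proj) (X t).snd
          (velocityAt I (fun r => (X r).proj) s t) +
        α (extChartAt I (X t).proj (X t).proj) η = 0 := by
  set p := (X t).proj with hp
  let x : F := (X t).snd
  let n : F := velocityAt I (fun r => (X r).proj) s t
  let ξ : F := h.projAt p (X t).snd
  have hσ : MDifferentiableWithinAt 𝓘(ℝ, ℝ) I.tangent (fun r => h.proj (X r)) s t :=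
    (h.contMDiff.mdifferentiable (by simp) (X t)).comp_mdifferentiableWithinAt t hX
  have hXp : MDifferentiableWithinAt 𝓘(ℝ, ℝ) I (fun r => (X r).proj) s t :=
    ((contMDiff_proj (n := ∞) (TangentSpace I)).mdifferentiable (by simp)
      (X t)).comp_mdifferentiableWithinAt t hX
  have hn : HasDerivWithinAt (fun r => extChartAt I p (X r).proj) n s t := by
    have := hasDerivWithinAt_extChartAt_comp hXp (x₀ := p) (mem_chart_source H p)
    rw [chartDeriv_self] at this
    exact this
  let A : F × F := velocityAt I.tangent (fun r => h.proj (X r)) s t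
  have hA : HasDerivWithinAt (fun r => (extChartAt I p (X r).proj,
      chartDeriv I p (X r).proj (h.projAt (X r).proj (X r).snd))) A s t := by
    have := hasDerivWithinAt_extChartAt_comp hσ (x₀ := h.proj (X t)) (mem_chart_source _ _)
    rw [chartDeriv_self] at this
    exact this
  have hA₁ : HasDerivWithinAt (fun r => extChartAt I p (X r).proj) A.1 s t := by
    simpa using hA.hasFDerivWithinAt.fst.hasDerivWithinAt
  have hA₂ : HasDerivWithinAt
      (fun r => chartDeriv I p (X r).proj (h.projAt (X r).proj (X r).snd)) A.2 s t := by
    simpa using hA.hasFDerivWithinAt.snd.hasDerivWithinAt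
  have hAn : A.1 = n := UniqueDiffWithinAt.eq_deriv s hs hA₁ hn
  -- The inner flip exchanges the fibre coordinate `ξ` of `PX` with the base velocity `A.1`, so `TP`
  -- is evaluated at the velocity of the base path, which lies in `S`. The outer flip leaves the
  -- last component untouched.
  have hcov : h.covDeriv (fun r => h.proj (X r)) s t =
      (mfderiv I.tangent I.tangent h.proj (⟨p, A.1⟩ : TangentBundle I N) (ξ, A.2) : F × F).2 := rfl
  have e₁ := h.apply_mfderiv_proj p hα hS (y := A.1) (by rw [hAn]; exact hβ) ξ A.2
  obtain ⟨c, hc⟩ : ∃ c : TangentSpace I p, c = h.covDeriv (fun r => h.proj (X r)) s t := ⟨_, rfl⟩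
  rw [← hcov, ← hc] at e₁
  have hαn := hα.hasFDerivAt.comp_hasDerivWithinAt t hn
  have hξt : chartDeriv I p (X t).proj (h.projAt (X t).proj (X t).snd) = ξ := chartDeriv_self _ _
  have hxt : chartDeriv I p (X t).proj (X t).snd = x := chartDeriv_self _ _
  -- Both sides are the derivative at `t` of one function, since `α(PX) = α(X)` along the path.
  have e₂ := UniqueDiffWithinAt.eq_deriv s hs
    (((hαn.clm_apply hA₂).congr_of_eventuallyEq (f₁ := fun r => α (extChartAt I p (X r).proj)
      (chartDeriv I p (X r).proj (X r).snd)) (by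
        filter_upwards [hXp.continuousWithinAt.eventually hS] with r hr
        have := (hr ((X r).snd - h.projAt (X r).proj (X r).snd)).1 (h.sub_projAt_mem _ _)
        rwa [map_sub, map_sub, sub_eq_zero] at this) (by
        have := (hS.self_of_nhds ((X t).snd - h.projAt p (X t).snd)).1 (h.sub_projAt_mem _ _)
        rwa [map_sub, map_sub, sub_eq_zero] at this))) (hαn.clm_apply hη)
  rw [hξt, hxt] at e₂
  obtain ⟨b, hb, e₃⟩ := h.exists_curvature_eq hα hS (h.sub_projAt_mem p (X t).snd) hβ
  have e₄ : ∀ u v : F, (fderiv ℝ α (extChartAt I p p)) (u - v) =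
      (fderiv ℝ α (extChartAt I p p)) u - (fderiv ℝ α (extChartAt I p p)) v := map_sub _
  have e₅ : α (extChartAt I p p) b = fderiv ℝ α (extChartAt I p p) n (x - ξ) -
      fderiv ℝ α (extChartAt I p p) (x - ξ) n := e₃
  rw [e₄, map_sub, _root_.sub_apply] at e₅
  have e₆ : operatorD I h X s t = (S p).mkQ c - (S p).mkQ b := by
    rw [← hb, hc]; rfl
  rw [e₆, ← map_sub, Submodule.mkQ_apply, Submodule.Quotient.mk_eq_zero, hS.self_of_nhds,
    chartDeriv_self]
  have e₇ : ∀ c d : F, α (extChartAt I p p) (c - d) =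
    α (extChartAt I p p) c - α (extChartAt I p p) d := map_sub _
  refine Eq.congr ((e₇ _ _).trans ?_) rfl
  rw [hAn] at e₁
  refine (congrArg₂ (· - ·) e₁ e₅).trans ?_
  change fderiv ℝ α (extChartAt I p p) n ξ + α (extChartAt I p p) A.2 =
    fderiv ℝ α (extChartAt I p p) n x + α (extChartAt I p p) η at e₂
  change _ = fderiv ℝ α (extChartAt I p p) x n + α (extChartAt I p p) η
  rw [← sub_eq_zero] at e₂ ⊢
  rw [← e₂]
  abel

end Coordinates

/-! ### Chart changes to second order. -/

section SecondOrder

variable {F : Type*} [NormedAddCommGroup F] [NormedSpace ℝ F] {H : Type*} [TopologicalSpace H]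
  {I : ModelWithCorners ℝ F H} {N : Type*} [TopologicalSpace N] [ChartedSpace H N]
  [IsManifold I ∞ N]

variable (I) in
/-- The change of coordinates from the preferred chart at `q` to the preferred chart at `p`. -/
noncomputable def transition (p q : N) (a : F) : F := extChartAt I p ((extChartAt I q).symm a)

variable (I) in
/-- The second derivative, at `q`, of the change of coordinates from the preferred chart at `q` to
the preferred chart at `p`. -/
noncomputable def transitionHess (p q : N) : F →L[ℝ] F →L[ℝ] F :=
  fderiv ℝ (fderiv ℝ (transition I p q)) (extChartAt I q q)

variable [I.Boundaryless]

theorem contDiffAt_transition {p q : N} (h : q ∈ (chartAt H p).source) :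
    ContDiffAt ℝ ∞ (transition I p q) (extChartAt I q q) := by
  have := contDiffWithinAt_ext_coord_change (I := I) (n := ∞) p q (y := extChartAt I q q)
    ((extChartAt I q).mem_symm_trans_source (mem_extChartAt_source q) (by simpa using h))
  rwa [I.range_eq_univ, contDiffWithinAt_univ] at this

theorem transitionHess_symm {p q : N} (h : q ∈ (chartAt H p).source) (u v : F) :
    transitionHess I p q u v = transitionHess I p q v u :=
  ((contDiffAt_transition h).isSymmSndFDerivAt
    (by simpa using! (ENat.LEInfty.out : (2 : WithTop ℕ∞) ≤ ∞))) u v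

theorem chartDeriv_comp {p q z : N} (hp : z ∈ (chartAt H p).source) (hq : z ∈ (chartAt H q).source)
    (v : TangentSpace I z) :
    chartDeriv I p z v = fderiv ℝ (transition I p q) (extChartAt I q z) (chartDeriv I q z v) := by
  have h := tangentCoordChange_comp (I := I) (w := z) (x := q) (y := p) (z := z) (v := v)
    (by simp [hp, hq])
  rw [tangentCoordChange_def (x := q), I.range_eq_univ, fderivWithin_univ] at h
  exact h.symm

theorem chartDeriv_eq_fderiv {p q : N} (hp : q ∈ (chartAt H p).source) (v : TangentSpace I q) :
    chartDeriv I p q v = fderiv ℝ (transition I p q) (extChartAt I q q) v := by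
  rw [chartDeriv_comp hp (mem_chart_source H q), chartDeriv_self]

theorem sectionRep_transition {p q : N} (h : q ∈ (chartAt H p).source)
    (V : Π q : N, TangentSpace I q) :
    ∀ᶠ a in 𝓝 (extChartAt I q q), sectionRep I p V (transition I p q a) =
      fderiv ℝ (transition I p q) a (sectionRep I q V a) := by
  filter_upwards [eventually_extChartAt_symm (I := I) ((chartAt H p).open_source.mem_nhds h),
    extChartAt_target_mem_nhds (I := I) q] with a ha hat
  rw [transition, sectionRep_apply ha, chartDeriv_comp ha (q := q)
    (by simpa using (extChartAt I q).map_target hat), (extChartAt I q).right_inv hat]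
  rfl

theorem sectionRep_extend (q : N) (y : TangentSpace I q) :
    ∀ᶠ a in 𝓝 (extChartAt I q q), sectionRep I q (extend F y) a = y := by
  filter_upwards [extChartAt_target_mem_nhds (I := I) q] with a hat
  have h : (extChartAt I q).symm a ∈ (chartAt H q).source := by
    simpa using (extChartAt I q).map_target hat
  have h1 := (trivializationAt F (TangentSpace I) q).apply_mk_symm (b := (extChartAt I q).symm a) h
    (y : F)
  have h2 : (trivializationAt F (TangentSpace I) q ⟨q, y⟩).2 = y := chartDeriv_self q y
  have h3 : extend F y ((extChartAt I q).symm a) = (trivializationAt F (TangentSpace I) q).symm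
    ((extChartAt I q).symm a) y := by rw [extend, h2]
  rw [sectionRep, h3]
  exact congrArg Prod.snd h1

omit [I.Boundaryless] in
theorem mdifferentiableAt_extend_tangent (q : N) (y : TangentSpace I q) :
    MDifferentiableAt I I.tangent (fun z => (⟨z, extend F y z⟩ : TangentBundle I N)) q :=
  (contMDiffAt_extend (k := ∞) I F y).mdifferentiableAt (by simp)

/-- Product and chain rule for `V_p(ψ(a)) = ψ'(a)V_q(a)`, with `ψ` the chart change. The Hessian
term is the obstruction to differentiating components invariantly. -/
theorem fderiv_sectionRep_transition {p q : N} (h : q ∈ (chartAt H p).source)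
    {V : Π q : N, TangentSpace I q}
    (hV : MDifferentiableAt I I.tangent (fun q => (⟨q, V q⟩ : TangentBundle I N)) q)
    (z : F) :
    fderiv ℝ (sectionRep I p V) (extChartAt I p q) (chartDeriv I p q z) =
      transitionHess I p q z (V q) +
      chartDeriv I p q (fderiv ℝ (sectionRep I q V) (extChartAt I q q) z : F) := by
  have hψ := contDiffAt_transition (I := I) h
  have hψq : transition I p q (extChartAt I q q) = extChartAt I p q := by
    rw [transition, extChartAt_to_inv]
  have h1 : HasFDerivAt (fderiv ℝ (transition I p q)) (transitionHess I p q) (extChartAt I q q) :=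
    ((hψ.fderiv_right (m := ∞) le_rfl).differentiableAt (by simp)).hasFDerivAt
  have h2 := h1.clm_apply
    (differentiableAt_sectionRep (mem_chart_source H q) hV).hasFDerivAt
  have h3 := HasFDerivAt.comp (extChartAt I q q) (by rw [hψq]; exact
    (differentiableAt_sectionRep h hV).hasFDerivAt) (hψ.differentiableAt (by simp)).hasFDerivAt
  have h4 := DFunLike.congr_fun
    (h3.unique (h2.congr_of_eventuallyEq (sectionRep_transition h V))) z
  rw [sectionRep_apply (mem_chart_source H q), chartDeriv_self] at h4
  have h5 : (chartDeriv I p q : F → F) = fderiv ℝ (transition I p q) (extChartAt I q q) :=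
    funext (chartDeriv_eq_fderiv h)
  rw [h5]
  exact h4.trans (add_comm _ _)

/-- The chart change of the tangent bundle is `(a, y) ↦ (ψ(a), ψ'(a)y)`; this is its derivative. -/
theorem chartDeriv_tangent {p q : N} (h : q ∈ (chartAt H p).source) (y₀ : TangentSpace I p)
    (y z w : F) :
    chartDeriv I.tangent (⟨p, y₀⟩ : TangentBundle I N) (⟨q, y⟩ : TangentBundle I N) (z, w) =
      (chartDeriv I p q z, transitionHess I p q z y + chartDeriv I p q w) := by
  have hψ := contDiffAt_transition (I := I) h
  have h1 : HasFDerivAt (fderiv ℝ (transition I p q)) (transitionHess I p q) (extChartAt I q q) :=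
    ((hψ.fderiv_right (m := ∞) le_rfl).differentiableAt (by simp)).hasFDerivAt
  set Y : TangentBundle I N := ⟨q, y⟩
  set Y₀ : TangentBundle I N := ⟨p, y₀⟩
  have hY : extChartAt I.tangent Y Y = (extChartAt I q q, y) := by
    rw [extChartAt_tangent_apply]
    exact congrArg _ (chartDeriv_self q y)
  have hYs : Y ∈ (chartAt (ModelProd H F) Y₀).source := by
    rw [TangentBundle.mem_chart_source_iff]; exact h
  let L : F × F →L[ℝ] F × F := chartDeriv I.tangent Y₀ Y
  have h2 : HasFDerivAt
      (fun A : F × F => extChartAt I.tangent Y₀ ((extChartAt I.tangent Y).symm A))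
      L (extChartAt I.tangent Y Y) :=
    hasFDerivAt_extChartAt_symm_chart (I := I.tangent) hYs
  have h3 : (fun A : F × F => extChartAt I.tangent Y₀ ((extChartAt I.tangent Y).symm A))
      =ᶠ[𝓝 (extChartAt I.tangent Y Y)]
      fun A => (transition I p q A.1, fderiv ℝ (transition I p q) A.1 A.2) := by
    filter_upwards [eventually_extChartAt_symm (I := I.tangent)
        (P := (· ∈ (chartAt (ModelProd H F) Y₀).source))
        ((chartAt (ModelProd H F) Y₀).open_source.mem_nhds hYs),
      extChartAt_target_mem_nhds (I := I.tangent) Y] with A hA hAt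
    set Z := (extChartAt I.tangent Y).symm A with hZ
    have hZY : Z ∈ (chartAt (ModelProd H F) Y).source := by
      have := (extChartAt I.tangent Y).map_target hAt
      rwa [extChartAt_source] at this
    rw [TangentBundle.mem_chart_source_iff] at hA hZY
    have hr : extChartAt I.tangent Y Z = A := (extChartAt I.tangent Y).right_inv hAt
    rw [← hr, extChartAt_tangent_apply, extChartAt_tangent_apply, transition,
      (extChartAt I q).left_inv (by simpa using hZY), chartDeriv_comp hA hZY]
  rw [hY] at h2 h3
  have h4 : HasFDerivAt (fun A : F × F => fderiv ℝ (transition I p q) A.1)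
      (transitionHess I p q ∘L ContinuousLinearMap.fst ℝ F F) (extChartAt I q q, y) :=
    HasFDerivAt.comp (𝕜 := ℝ) (f := Prod.fst) (extChartAt I q q, (y : F)) h1 hasFDerivAt_fst
  have h5 : HasFDerivAt (fun A : F × F => transition I p q A.1)
      (fderiv ℝ (transition I p q) (extChartAt I q q) ∘L ContinuousLinearMap.fst ℝ F F)
      (extChartAt I q q, y) :=
    HasFDerivAt.comp (𝕜 := ℝ) (f := Prod.fst) (extChartAt I q q, y)
      (hψ.differentiableAt (by simp)).hasFDerivAt hasFDerivAt_fst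
  have h6 := h5.prodMk (h4.clm_apply hasFDerivAt_snd)
  have h7 := DFunLike.congr_fun (h2.unique
    (h6.congr_of_eventuallyEq h3)) (z, w)
  have h8 : (chartDeriv I p q : F → F) = fderiv ℝ (transition I p q) (extChartAt I q q) :=
    funext (chartDeriv_eq_fderiv h)
  rw [h8]
  exact h7.trans (congrArg _ (add_comm _ _))

end SecondOrder

/-! ### Christoffel symbols and their differentiability. -/

section Christoffel

/-- In finite dimension an operator is a finite combination of its values on a basis. -/
theorem differentiableAt_clm_of_apply {D E G : Type*} [NormedAddCommGroup D] [NormedSpace ℝ D]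
    [NormedAddCommGroup E] [NormedSpace ℝ E] [FiniteDimensional ℝ E] [NormedAddCommGroup G]
    [NormedSpace ℝ G] {f : D → E →L[ℝ] G} {x : D}
    (h : ∀ y, DifferentiableAt ℝ (fun a => f a y) x) : DifferentiableAt ℝ f x := by
  let b := Module.finBasis ℝ E
  have hf : f = fun a => ∑ i, ContinuousLinearMap.smulRightL ℝ E G
      (LinearMap.toContinuousLinearMap (b.coord i)) (f a (b i)) := by
    funext a
    ext y
    conv_lhs => rw [← b.sum_repr y, map_sum]
    simp [_root_.sum_apply]
  rw [hf]
  exact DifferentiableAt.fun_sum fun i _ =>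
    (ContinuousLinearMap.differentiableAt _).comp x (h (b i))

variable {F : Type*} [NormedAddCommGroup F] [NormedSpace ℝ F] {H : Type*} [TopologicalSpace H]
  {I : ModelWithCorners ℝ F H} {N : Type*} [TopologicalSpace N] [ChartedSpace H N]
  [IsManifold I ∞ N]

variable (I) in
/-- The tangent vector at `q` with given components in the preferred chart at `p`. -/
noncomputable def chartDerivInv (p q : N) : F →L[ℝ] TangentSpace I q :=
  (tangentCoordChange I p q q : F →L[ℝ] F)

theorem chartDeriv_chartDerivInv {p q : N} (h : q ∈ (chartAt H p).source) (v : F) :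
    chartDeriv I p q (chartDerivInv I p q v) = v :=
  (tangentCoordChange_comp (I := I) (w := p) (x := q) (y := p) (z := q) (v := v)
    (by simp [h])).trans (tangentCoordChange_self (by simpa using h))

theorem chartDerivInv_chartDeriv {p q : N} (h : q ∈ (chartAt H p).source) (v : TangentSpace I q) :
    chartDerivInv I p q (chartDeriv I p q v) = v :=
  (tangentCoordChange_comp (I := I) (w := q) (x := p) (y := q) (z := q) (v := v)
    (by simp [h])).trans (tangentCoordChange_self (by simp))

variable (I) in
/-- The covariant derivative for which the fields with constant components in the preferred chart
at `p` are parallel. -/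
noncomputable def flatCov (p : N) (σ : Π q : N, TangentSpace I q) (q : N) :
    TangentSpace I q →L[ℝ] TangentSpace I q :=
  chartDerivInv I p q ∘L fderiv ℝ (sectionRep I p σ) (extChartAt I p q) ∘L chartDeriv I p q

variable [I.Boundaryless]

theorem isCovariantDerivativeOn_flatCov (p : N) :
    IsCovariantDerivativeOn F (flatCov I p) (chartAt H p).source where
  add {σ σ' q} hσ hσ' hq := by
    have h := fderiv_fun_add (differentiableAt_sectionRep hq hσ) (differentiableAt_sectionRep hq hσ')
    have h' : sectionRep I p (σ + σ') = fun a => sectionRep I p σ a + sectionRep I p σ' a :=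
      funext fun a => map_add _ _ _
    ext v
    rw [flatCov, h', h]
    simp [flatCov]
  leibniz {σ g q} hσ hg hq := by
    have hl : (extChartAt I p).symm (extChartAt I p q) = q :=
      (extChartAt I p).left_inv (by simpa using hq)
    have hgs : DifferentiableAt ℝ (fun a => g ((extChartAt I p).symm a)) (extChartAt I p q) :=
      (MDifferentiableAt.comp_of_eq (x := extChartAt I p q) hg
        (mdifferentiableAt_extChartAt_symm ((extChartAt I p).map_source (by simpa using hq)))
        hl).differentiableAt
    have h := fderiv_fun_smul hgs (differentiableAt_sectionRep hq hσ)
    have h' : sectionRep I p (g • σ) =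
        fun a => g ((extChartAt I p).symm a) • sectionRep I p σ a :=
      funext fun a => map_smul _ _ _
    ext v
    have h1 : fderiv ℝ (fun a => g ((extChartAt I p).symm a)) (extChartAt I p q)
        (chartDeriv I p q v) = mvfderiv I g q v := by
      have := (hgs.hasFDerivAt.hasMFDerivAt.comp q (hasMFDerivAt_extChartAt' hq)).congr_of_eventuallyEq
        (f₁ := g) (by
          filter_upwards [(chartAt H p).open_source.mem_nhds hq] with z hz
          rw [Function.comp_apply, (extChartAt I p).left_inv (by simpa using hz)])
      rw [mvfderiv, this.mfderiv]
      rfl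
    rw [flatCov, h', h]
    simp only [ContinuousLinearMap.comp_apply, _root_.add_apply, _root_.smul_apply, map_add,
      map_smul, hl, ContinuousLinearMap.smulRight_apply, h1, sectionRep_apply hq,
      chartDerivInv_chartDeriv hq, flatCov]

variable [FiniteDimensional ℝ F] (cov : CovariantDerivative I F (TangentSpace I : N → Type _))

omit [I.Boundaryless] in
-- A bump function makes the locally constant field globally smooth, so that the smoothness of the
-- connection, stated for sections, can be applied to it.
theorem exists_contMDiff_eq_extend [T2Space N] (p : N) (y : TangentSpace I p) :
    ∃ σ : Π q : N, TangentSpace I q,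
      ContMDiff I I.tangent ∞ (fun q => (⟨q, σ q⟩ : TangentBundle I N)) ∧
        ∀ᶠ q in 𝓝 p, σ q = extend F y q := by
  obtain ⟨u, hu, huσ⟩ := exists_contMDiffOn_extend (k := ∞) I F (V := (TangentSpace I : N → Type _)) y
  obtain ⟨f, -, hf⟩ := (SmoothBumpFunction.nhds_basis_tsupport (I := I) p).mem_iff.1
    (interior_mem_nhds.2 hu)
  refine ⟨(f : N → ℝ) • extend F y, ContMDiffOn.smul_section_of_tsupport f.contMDiff.contMDiffOn
    isOpen_interior hf (huσ.mono interior_subset), ?_⟩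
  filter_upwards [f.eventuallyEq_one] with q hq
  simp [hq]

/-- The Christoffel symbols of a linear connection in the preferred chart at `p`:
`christoffel cov p a y v` consists of the components of `∇_v σ` at the point with coordinates `a`,
where `σ` is the field with constant components `y`. -/
noncomputable def christoffel (p : N) (a : F) : F →L[ℝ] F →L[ℝ] F :=
  let q := (extChartAt I p).symm a
  let A : F →L[ℝ] F := chartDeriv I p q
  let B : F →L[ℝ] F := chartDerivInv I p q
  let D : F →L[ℝ] F →L[ℝ] F := IsCovariantDerivativeOn.difference (s := (chartAt H p).source)
    cov.isCovariantDerivativeOn (isCovariantDerivativeOn_flatCov p) q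
  ContinuousLinearMap.compL ℝ F F F A ∘L (ContinuousLinearMap.compL ℝ F F F).flip B ∘L D ∘L B

/-- The difference of the connection and the flat one of the chart is a tensor; `christoffel` is
this tensor conjugated into the chart. -/
theorem chartDeriv_cov {p q : N} (h : q ∈ (chartAt H p).source) {σ : Π q : N, TangentSpace I q}
    (hσ : MDifferentiableAt I I.tangent (fun q => (⟨q, σ q⟩ : TangentBundle I N)) q)
    (v : TangentSpace I q) :
    chartDeriv I p q (cov σ q v) =
      fderiv ℝ (sectionRep I p σ) (extChartAt I p q) (chartDeriv I p q v) +
        christoffel cov p (extChartAt I p q) (chartDeriv I p q (σ q)) (chartDeriv I p q v) := by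
  have hl : (extChartAt I p).symm (extChartAt I p q) = q :=
    (extChartAt I p).left_inv (by simpa using h)
  have h1 : ∀ (w : TangentSpace I q) (v : TangentSpace I q),
      christoffel cov p (extChartAt I p q) (chartDeriv I p q w) (chartDeriv I p q v) =
      chartDeriv I p q (IsCovariantDerivativeOn.difference (s := (chartAt H p).source)
        cov.isCovariantDerivativeOn (isCovariantDerivativeOn_flatCov p) q w v) := by
    intro w v
    have h2 : ∀ q', q' = q →
        chartDeriv I p q' (IsCovariantDerivativeOn.difference (s := (chartAt H p).source)
        cov.isCovariantDerivativeOn (isCovariantDerivativeOn_flatCov p) q'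
        (chartDerivInv I p q' (chartDeriv I p q w)) (chartDerivInv I p q' (chartDeriv I p q v))) =
        chartDeriv I p q (IsCovariantDerivativeOn.difference (s := (chartAt H p).source)
        cov.isCovariantDerivativeOn (isCovariantDerivativeOn_flatCov p) q w v) := by
      rintro _ rfl
      rw [chartDerivInv_chartDeriv h, chartDerivInv_chartDeriv h]
    exact h2 _ hl
  rw [h1, IsCovariantDerivativeOn.difference_apply _ _ h hσ, _root_.sub_apply, map_sub, flatCov,
    ContinuousLinearMap.comp_apply, ContinuousLinearMap.comp_apply, chartDeriv_chartDerivInv h]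
  exact (add_sub_cancel _ _).symm

/-- For fixed `y` and `v`, `Γ(y)v` is near the centre the component function of a field `∇_V σ` with
`σ`, `V` of constant components, and that field is smooth at `p`. -/
theorem differentiableAt_christoffel [T2Space N] [cov.ContMDiffCovariantDerivative ∞] (p : N) :
    DifferentiableAt ℝ (christoffel cov p) (extChartAt I p p) := by
  refine differentiableAt_clm_of_apply fun y => differentiableAt_clm_of_apply fun v => ?_
  obtain ⟨σ, hσ, hσy⟩ := exists_contMDiff_eq_extend (I := I) p y
  have h1 : ContMDiffAt I I.tangent ∞
      (fun q => (⟨q, extend F (x := p) v q⟩ : TangentBundle I N)) p :=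
    contMDiffAt_extend I F (V := (TangentSpace I : N → Type _)) (x := p) v
  have h2 := (CovariantDerivative.ContMDiffCovariantDerivative.contMDiff (cov := cov)
    (k := ∞)).contMDiff (σ := σ) hσ.contMDiffOn
  have h3 := ContMDiffAt.clm_bundle_apply (h2.contMDiffAt Filter.univ_mem) h1
  have h4 := differentiableAt_sectionRep (mem_chart_source H p) (h3.mdifferentiableAt (by simp))
  refine h4.congr_of_eventuallyEq ?_
  filter_upwards [(eventually_extChartAt_symm (I := I) hσy).eventually_nhds,
    (sectionRep_extend p v), (sectionRep_extend p y).eventually_nhds,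
    extChartAt_target_mem_nhds (I := I) p] with a ha hv hy hat
  have hq : (extChartAt I p).symm a ∈ (chartAt H p).source := by
    simpa using (extChartAt I p).map_target hat
  have h5 : sectionRep I p σ =ᶠ[𝓝 a] fun _ => y := by
    filter_upwards [ha, hy] with b hb hb'
    rw [sectionRep, hb]
    exact hb'
  have hr := (extChartAt I p).right_inv hat
  have h6 := chartDeriv_cov cov hq (hσ.mdifferentiable (by simp) _)
    (extend F (x := p) v ((extChartAt I p).symm a))
  have hv' : chartDeriv I p ((extChartAt I p).symm a)
    (extend F (x := p) v ((extChartAt I p).symm a)) = v := hv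
  have hy' : chartDeriv I p ((extChartAt I p).symm a) (σ ((extChartAt I p).symm a)) = y :=
    h5.self_of_nhds
  rw [hr, hv', hy', h5.fderiv_eq, fderiv_fun_const] at h6
  exact (h6.trans (zero_add _)).symm

end Christoffel

/-! ### Vertical projection, horizontal bundle, torsion and curvature in components. -/

section ConnectionCoordinates

theorem HasFDerivAt.exists_uncurry {X Y Z : Type*} [NormedAddCommGroup X] [NormedSpace ℝ X]
    [NormedAddCommGroup Y] [NormedSpace ℝ Y] [NormedAddCommGroup Z] [NormedSpace ℝ Z]
    {f : X → Y →L[ℝ] Z} {f' : X →L[ℝ] Y →L[ℝ] Z} {a : X} (hf : HasFDerivAt f f' a) (v : Y) :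
    ∃ L : X × Y →L[ℝ] Z, HasFDerivAt (fun A : X × Y => f A.1 A.2) L (a, v) ∧
      ∀ b c, L (b, c) = f' b v + f a c := by
  have h1 : HasFDerivAt (fun A : X × Y => f A.1) (f' ∘L ContinuousLinearMap.fst ℝ X Y) (a, v) :=
    HasFDerivAt.comp (𝕜 := ℝ) (f := Prod.fst) (a, v) hf hasFDerivAt_fst
  refine ⟨_, h1.clm_apply hasFDerivAt_snd, fun b c => ?_⟩
  simp [add_comm]

theorem HasFDerivAt.apply_const {X Y Z : Type*} [NormedAddCommGroup X] [NormedSpace ℝ X]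
    [NormedAddCommGroup Y] [NormedSpace ℝ Y] [NormedAddCommGroup Z] [NormedSpace ℝ Z]
    {f : X → Y →L[ℝ] Z} {f' : X →L[ℝ] Y →L[ℝ] Z} {a : X} (hf : HasFDerivAt f f' a) (y : Y) :
    HasFDerivAt (fun x => f x y) (ContinuousLinearMap.apply ℝ Z y ∘L f') a :=
  (ContinuousLinearMap.apply ℝ Z y).hasFDerivAt.comp a hf

variable {F : Type*} [NormedAddCommGroup F] [NormedSpace ℝ F] {H : Type*} [TopologicalSpace H]
  {I : ModelWithCorners ℝ F H} {N : Type*} [TopologicalSpace N] [ChartedSpace H N]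
  [IsManifold I ∞ N] [I.Boundaryless]

theorem mfderiv_proj_apply (Y : TangentBundle I N) (A : F × F) :
    mfderiv I.tangent I (fun Z : TangentBundle I N => Z.proj) Y A = A.1 := by
  have h1 := ((contMDiff_proj (n := ∞) (IB := I) (F := F) (TangentSpace I : N → Type _)).mdifferentiable
    (by simp) Y).hasMFDerivAt
  let L : F × F →L[ℝ] F := mfderiv I.tangent I (fun Z : TangentBundle I N => Z.proj) Y
  have h2 : HasFDerivWithinAt
      (writtenInExtChartAt I.tangent I Y (fun Z : TangentBundle I N => Z.proj)) L
      (range I.tangent) (extChartAt I.tangent Y Y) := h1.2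
  rw [ModelWithCorners.range_eq_univ] at h2
  have h3 : HasFDerivAt (fun A : F × F => A.1) (ContinuousLinearMap.fst ℝ F F)
    (extChartAt I.tangent Y Y) := hasFDerivAt_fst
  have h4 := (hasFDerivWithinAt_univ.1 h2).unique (h3.congr_of_eventuallyEq (by
    filter_upwards [extChartAt_target_mem_nhds (I := I.tangent) Y] with A hA
    exact congrArg Prod.fst ((extChartAt I.tangent Y).right_inv hA)))
  exact DFunLike.congr_fun h4 A

theorem mfderiv_extend_apply (q : N) (y z : F) :
    mfderiv I I.tangent (fun q' => (⟨q', extend F (x := q) y q'⟩ : TangentBundle I N)) q z =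
      ((z, 0) : F × F) := by
  have h1 := (mdifferentiableAt_extend_tangent (I := I) q y).hasMFDerivAt
  let L : F →L[ℝ] F × F :=
    mfderiv I I.tangent (fun q' => (⟨q', extend F (x := q) y q'⟩ : TangentBundle I N)) q
  have h2 : HasFDerivWithinAt (writtenInExtChartAt I I.tangent q
    (fun q' => (⟨q', extend F (x := q) y q'⟩ : TangentBundle I N))) L (range I)
    (extChartAt I q q) := h1.2
  rw [ModelWithCorners.range_eq_univ] at h2
  have h3 : HasFDerivAt (fun a : F => (a, y)) (ContinuousLinearMap.inl ℝ F F) (extChartAt I q q) :=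
    hasFDerivAt_prodMk_left _ _
  have h4 := (hasFDerivWithinAt_univ.1 h2).unique (h3.congr_of_eventuallyEq (by
    filter_upwards [extChartAt_target_mem_nhds (I := I) q, sectionRep_extend (I := I) q y] with a ha hy
    refine Prod.ext ((extChartAt I q).right_inv ha) (Eq.trans ?_ hy)
    rfl))
  exact DFunLike.congr_fun h4 z

theorem fderiv_sectionRep_extend (q : N) (y : TangentSpace I q) :
    fderiv ℝ (sectionRep I q (extend F y)) (extChartAt I q q) = 0 :=
  ((hasFDerivAt_const (F := F) y _).congr_of_eventuallyEq (sectionRep_extend q y)).fderiv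

variable (cov : CovariantDerivative I F (TangentSpace I : N → Type _))

/-- The field used in `connector` is constant in the chart, so its derivative is `z ↦ (z, 0)` and
has no vertical part. -/
theorem connector_apply (q : N) (y z w : TangentSpace I q) :
    connector cov (⟨q, y⟩ : TangentBundle I N) ((z, w) : F × F) =
      w + cov (extend F y) q z := by
  have h1 : mfderiv I.tangent I (fun Z : TangentBundle I N => Z.proj) (⟨q, y⟩ : TangentBundle I N)
    ((z, w) : F × F) = z := mfderiv_proj_apply _ _
  have h2 : verticalPart I (⟨q, y⟩ : TangentBundle I N) (mfderiv I I.tangent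
      (fun q' => (⟨q', extend F y q'⟩ : TangentBundle I N)) q z) = 0 :=
    congrArg Prod.snd (mfderiv_extend_apply (I := I) q y z)
  have h3 : connector cov (⟨q, y⟩ : TangentBundle I N) ((z, w) : F × F) =
      verticalPart I (⟨q, y⟩ : TangentBundle I N) ((z, w) : F × F) -
        verticalPart I (⟨q, y⟩ : TangentBundle I N) (mfderiv I I.tangent
          (fun q' => (⟨q', extend F y q'⟩ : TangentBundle I N)) q
          (mfderiv I.tangent I (fun Z : TangentBundle I N => Z.proj)
            (⟨q, y⟩ : TangentBundle I N) ((z, w) : F × F))) +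
      cov (extend F y) q (mfderiv I.tangent I (fun Z : TangentBundle I N => Z.proj)
        (⟨q, y⟩ : TangentBundle I N) ((z, w) : F × F)) :=
    congrArg (fun u => u + cov (extend F y) q (mfderiv I.tangent I
      (fun Z : TangentBundle I N => Z.proj) (⟨q, y⟩ : TangentBundle I N) ((z, w) : F × F)))
      (map_sub (verticalPart I (⟨q, y⟩ : TangentBundle I N)) _ _)
  rw [h3, h1, h2, sub_zero]
  rfl

variable [FiniteDimensional ℝ F]

/-- The field is constant in the chart at `q`, not in the one at `p`; its components at `p` vary,
and their derivative is the Hessian term. -/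
theorem chartDeriv_cov_extend {p q : N} (h : q ∈ (chartAt H p).source) (y z : TangentSpace I q) :
    chartDeriv I p q (cov (extend F y) q z) =
      transitionHess I p q z y +
        christoffel cov p (extChartAt I p q) (chartDeriv I p q y) (chartDeriv I p q z) := by
  rw [chartDeriv_cov cov h (mdifferentiableAt_extend_tangent q y)]
  have h1 := fderiv_sectionRep_transition h (mdifferentiableAt_extend_tangent (I := I) q y) z
  rw [fderiv_sectionRep_extend, extend_apply_self] at h1
  rw [extend_apply_self]
  refine congrArg₂ (· + ·) (h1.trans ?_) rfl
  exact (congrArg₂ (· + ·) rfl (map_zero _)).trans (add_zero _)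

/-- The vertical projection of a linear connection in the preferred chart at `p`. -/
noncomputable def connectorRep (p : N) (A : F × F) : F × F →L[ℝ] F :=
  ContinuousLinearMap.snd ℝ F F + christoffel cov p A.1 A.2 ∘L ContinuousLinearMap.fst ℝ F F

/-- The Hessian from the field that is constant at `q` equals the one from the chart change of the
tangent bundle, so a single formula holds throughout the fixed chart. -/
theorem chartDeriv_connector {p q : N} (h : q ∈ (chartAt H p).source) (y₀ : TangentSpace I p)
    (y : TangentSpace I q) (A : F × F) :
    chartDeriv I p q (connector cov (⟨q, y⟩ : TangentBundle I N) A) =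
      connectorRep cov p (extChartAt I p q, chartDeriv I p q y)
        (chartDeriv I.tangent (⟨p, y₀⟩ : TangentBundle I N) (⟨q, y⟩ : TangentBundle I N) A) := by
  obtain ⟨z, w⟩ := A
  have h1 := chartDeriv_cov_extend cov h y z
  have h2 := chartDeriv_tangent h y₀ y z w
  refine (congrArg (chartDeriv I p q) (connector_apply cov q y z w)).trans ?_
  refine ((map_add (chartDeriv I p q) _ _).trans (congrArg₂ (· + ·) rfl h1)).trans ?_
  refine Eq.trans ?_ (congrArg _ h2.symm)
  change chartDeriv I p q w + (transitionHess I p q z y +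
    christoffel cov p (extChartAt I p q) (chartDeriv I p q y) (chartDeriv I p q z)) =
    transitionHess I p q z y + chartDeriv I p q w +
    christoffel cov p (extChartAt I p q) (chartDeriv I p q y) (chartDeriv I p q z)
  abel

theorem mem_horizontal_iff {p : N} {Y : TangentBundle I N} (h : Y.proj ∈ (chartAt H p).source)
    (y₀ : TangentSpace I p) (A : F × F) :
    (A : TangentSpace I.tangent Y) ∈ horizontal cov Y ↔
      connectorRep cov p (extChartAt I.tangent (⟨p, y₀⟩ : TangentBundle I N) Y)
        (chartDeriv I.tangent (⟨p, y₀⟩ : TangentBundle I N) Y A) = 0 := by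
  have h1 := chartDeriv_connector cov h y₀ Y.snd A
  have h2 : (A : TangentSpace I.tangent Y) ∈ horizontal cov Y ↔ connector cov Y A = 0 := Iff.rfl
  rw [h2, ← map_eq_zero_iff _ (chartDeriv_bijective h).injective]
  exact Eq.congr h1 rfl

theorem hasFDerivAt_connectorRep {p : N} {a : F}
    (hΓ : DifferentiableAt ℝ (christoffel cov p) a) (v : F) :
    ∃ L : F × F →L[ℝ] F × F →L[ℝ] F, HasFDerivAt (connectorRep cov p) L (a, v) ∧
      ∀ b c b' c' : F, L (b, c) (b', c') =
        fderiv ℝ (christoffel cov p) a b v b' + christoffel cov p a c b' := by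
  obtain ⟨L, hL, hL'⟩ := HasFDerivAt.exists_uncurry hΓ.hasFDerivAt v
  have h := ((ContinuousLinearMap.compL ℝ (F × F) F F).flip
    (ContinuousLinearMap.fst ℝ F F)).hasFDerivAt.comp (a, v) hL
  refine ⟨_, h.const_add (ContinuousLinearMap.snd ℝ F F), fun b c b' c' => ?_⟩
  exact DFunLike.congr_fun (hL' b c) b'

theorem chartDeriv_covAlong {p : N} {γ : ℝ → N} {s : Set ℝ} {r : ℝ} (hr : r ∈ s)
    (hs : UniqueDiffWithinAt ℝ s r) (h : ∀ᶠ r' in 𝓝[s] r, γ r' ∈ (chartAt H p).source)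
    {W : Π t : ℝ, TangentSpace I (γ t)} {x' w' : F}
    (hx : HasDerivWithinAt (fun r => extChartAt I p (γ r)) x' s r)
    (hw : HasDerivWithinAt (fun r => chartDeriv I p (γ r) (W r)) w' s r) :
    chartDeriv I p (γ r) (covAlong cov γ s W r) =
      w' + christoffel cov p (extChartAt I p (γ r)) (chartDeriv I p (γ r) (W r)) x' := by
  have h0 := h.self_of_nhdsWithin hr
  have hd := hx.prodMk hw
  have hc : MDifferentiableWithinAt 𝓘(ℝ, ℝ) I.tangent
      (fun r => (⟨γ r, W r⟩ : TangentBundle I N)) s r := by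
    refine mdifferentiableWithinAt_of_extChartAt_comp (x₀ := (⟨p, 0⟩ : TangentBundle I N)) hr ?_
      hd.differentiableWithinAt
    filter_upwards [h] with r' hr'
    rw [TangentBundle.mem_chart_source_iff]
    exact hr'
  have hv := hasDerivWithinAt_extChartAt_comp (x₀ := (⟨p, 0⟩ : TangentBundle I N)) hc
    (by rw [TangentBundle.mem_chart_source_iff]; exact h0)
  have he := UniqueDiffWithinAt.eq_deriv s hs hv hd
  have h1 := chartDeriv_connector cov h0 0 (W r)
    (velocityAt I.tangent (fun r => (⟨γ r, W r⟩ : TangentBundle I N)) s r)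
  refine h1.trans ?_
  erw [he]
  rfl

omit [FiniteDimensional ℝ F] in
theorem mlieBracket_extend (q : N) (u v : TangentSpace I q) :
    VectorField.mlieBracket I (extend F u) (extend F v) q = 0 := by
  rw [mlieBracket_eq_fderiv, fderiv_sectionRep_extend, fderiv_sectionRep_extend]
  exact sub_self (0 : F)

/-- The bracket of the two constant fields is zero at `q`, and the two Hessian terms cancel by
symmetry. -/
theorem chartDeriv_torsion [CompleteSpace F] {p q : N} (h : q ∈ (chartAt H p).source)
    (u v : TangentSpace I q) :
    chartDeriv I p q (cov.torsion q u v) =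
      christoffel cov p (extChartAt I p q) (chartDeriv I p q v) (chartDeriv I p q u) -
        christoffel cov p (extChartAt I p q) (chartDeriv I p q u) (chartDeriv I p q v) := by
  rw [cov.torsion_apply_eq_extend, mlieBracket_extend, sub_zero, map_sub, extend_apply_self,
    extend_apply_self, chartDeriv_cov_extend cov h, chartDeriv_cov_extend cov h]
  have h1 : transitionHess I p q u v = transitionHess I p q v u := transitionHess_symm h _ _
  exact (congrArg₂ (· - ·) (congrArg (· + _) h1) rfl).trans (add_sub_add_left_eq_sub _ _ _)

variable [T2Space N] [cov.ContMDiffCovariantDerivative ∞]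

/-- Near `p` the inner field has components `Γ(a)(w)v`. Its covariant derivative is the derivative
of these components plus another application of `Γ`. -/
theorem cov_cov_extend (p : N) (u v w : TangentSpace I p) :
    cov (fun q => cov (extend F w) q (extend F v q)) p u =
      (fderiv ℝ (christoffel cov p) (extChartAt I p p) u w v +
        christoffel cov p (extChartAt I p p) (christoffel cov p (extChartAt I p p) w v) u : F) := by
  have h1 : ∀ᶠ q in 𝓝 p, MDifferentiableAt I I.tangent
      (fun z => (⟨z, extend F w z⟩ : TangentBundle I N)) q := by
    obtain ⟨u, hu, h⟩ := exists_mdifferentiableOn_extend I F (V := (TangentSpace I : N → Type _)) w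
    filter_upwards [eventually_mem_nhds_iff.2 hu] with q hq
    exact (h q (mem_of_mem_nhds hq)).mdifferentiableAt hq
  have h2 : sectionRep I p (fun q => cov (extend F w) q (extend F v q)) =ᶠ[𝓝 (extChartAt I p p)]
      fun a => christoffel cov p a w v := by
    filter_upwards [eventually_extChartAt_symm (I := I) h1, sectionRep_extend p v,
      (sectionRep_extend p w).eventually_nhds, extChartAt_target_mem_nhds (I := I) p]
      with a ha hv hw hat
    have hq : (extChartAt I p).symm a ∈ (chartAt H p).source := by
      simpa using (extChartAt I p).map_target hat
    have h3 := chartDeriv_cov cov hq ha (extend F v ((extChartAt I p).symm a))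
    have h4 : fderiv ℝ (sectionRep I p (extend F w)) a = 0 :=
      ((hasFDerivAt_const (F := F) w _).congr_of_eventuallyEq hw).fderiv
    have hv' : chartDeriv I p ((extChartAt I p).symm a) (extend F v ((extChartAt I p).symm a)) = v :=
      hv
    have hw' : chartDeriv I p ((extChartAt I p).symm a) (extend F w ((extChartAt I p).symm a)) = w :=
      hw.self_of_nhds
    rw [(extChartAt I p).right_inv hat, h4, hv', hw'] at h3
    exact h3.trans (zero_add _)
  have hΓ := differentiableAt_christoffel cov p
  have h5 := HasFDerivAt.apply_const (HasFDerivAt.apply_const hΓ.hasFDerivAt w) v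
  have h6 := h5.congr_of_eventuallyEq h2
  have h7 : MDifferentiableAt I I.tangent
      (fun q => (⟨q, cov (extend F w) q (extend F v q)⟩ : TangentBundle I N)) p := by
    refine mdifferentiableAt_of_extChartAt_comp_symm (x₀ := p) (y₀ := (⟨p, 0⟩ : TangentBundle I N))
      (mem_chart_source H p) ?_ ?_
    · filter_upwards [(chartAt H p).open_source.mem_nhds (mem_chart_source H p)] with q hq
      rw [TangentBundle.mem_chart_source_iff]
      exact hq
    · refine DifferentiableAt.prodMk ?_ h6.differentiableAt
      refine differentiableAt_id.congr_of_eventuallyEq ?_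
      filter_upwards [extChartAt_target_mem_nhds (I := I) p] with a ha
      exact (extChartAt I p).right_inv ha
  have h8 := chartDeriv_cov cov (mem_chart_source H p) h7 u
  rw [chartDeriv_self, h6.fderiv] at h8
  refine h8.trans ?_
  rw [← sectionRep_apply (mem_chart_source H p)
    (fun q => cov (extend F w) q (extend F v q)), h2.self_of_nhds, chartDeriv_self]
  rfl

theorem riemann_eq (p : N) (u v w : TangentSpace I p) :
    riemann cov p u v w =
      (fderiv ℝ (christoffel cov p) (extChartAt I p p) u w v +
        christoffel cov p (extChartAt I p p) (christoffel cov p (extChartAt I p p) w v) u -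
       (fderiv ℝ (christoffel cov p) (extChartAt I p p) v w u +
        christoffel cov p (extChartAt I p p) (christoffel cov p (extChartAt I p p) w u) v) : F) := by
  rw [riemann]
  simp only [mlieBracket_extend, map_zero, sub_zero]
  exact congrArg₂ (· - ·) (cov_cov_extend cov p u v w) (cov_cov_extend cov p v u w)

end ConnectionCoordinates

/-! ### Velocities of fields along curves and the canonical involution. -/

section Curves

variable {F : Type*} [NormedAddCommGroup F] [NormedSpace ℝ F] {H : Type*} [TopologicalSpace H]
  {I : ModelWithCorners ℝ F H} {N : Type*} [TopologicalSpace N] [ChartedSpace H N]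
  [IsManifold I ∞ N] {γ : ℝ → N} {s : Set ℝ} {t : ℝ} {p : N}

theorem contDiffWithinAt_extChartAt_comp (hγ : ContMDiffWithinAt 𝓘(ℝ, ℝ) I ∞ γ s t)
    (h : γ t ∈ (chartAt H p).source) :
    ContDiffWithinAt ℝ ∞ (fun r => extChartAt I p (γ r)) s t :=
  ((contMDiffAt_extChartAt' h).comp_contMDiffWithinAt t hγ).contDiffWithinAt

theorem derivWithin_extChartAt_comp (hγ : MDifferentiableWithinAt 𝓘(ℝ, ℝ) I γ s t)
    (hs : UniqueDiffWithinAt ℝ s t) (h : γ t ∈ (chartAt H p).source) :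
    derivWithin (fun r => extChartAt I p (γ r)) s t =
      chartDeriv I p (γ t) (velocityAt I γ s t) :=
  (hasDerivWithinAt_extChartAt_comp hγ h).derivWithin hs

theorem hasDerivWithinAt_derivWithin {f : ℝ → F} (hf : ContDiffWithinAt ℝ ∞ f s t)
    (hs : UniqueDiffOn ℝ s) (ht : t ∈ s) :
    HasDerivWithinAt (derivWithin f s) (derivWithin (derivWithin f s) s t) s t := by
  have := (hf.fderivWithin_right (m := ∞) hs le_rfl ht).clm_apply
    (contDiffWithinAt_const (c := (1 : ℝ)))
  exact (this.differentiableWithinAt (by simp)).hasDerivWithinAt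

variable {Z : Π t : ℝ, TangentSpace I (γ t)}

theorem contDiffWithinAt_chartDeriv_comp
    (hZ : ContMDiffWithinAt 𝓘(ℝ, ℝ) I.tangent ∞ (fun t => (⟨γ t, Z t⟩ : TangentBundle I N)) s t)
    (h : γ t ∈ (chartAt H p).source) :
    ContDiffWithinAt ℝ ∞ (fun r => chartDeriv I p (γ r) (Z r)) s t :=
  (contDiffWithinAt_extChartAt_comp (p := (⟨p, 0⟩ : TangentBundle I N)) hZ
    (by rw [TangentBundle.mem_chart_source_iff]; exact h)).snd

theorem velocityAt_eq (hs : UniqueDiffWithinAt ℝ s t)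
    (hZ : MDifferentiableWithinAt 𝓘(ℝ, ℝ) I.tangent
      (fun t => (⟨γ t, Z t⟩ : TangentBundle I N)) s t) :
    velocityAt I.tangent (fun t => (⟨γ t, Z t⟩ : TangentBundle I N)) s t =
      ((velocityAt I γ s t,
        derivWithin (fun r => chartDeriv I (γ t) (γ r) (Z r)) s t) : F × F) := by
  have hγ : MDifferentiableWithinAt 𝓘(ℝ, ℝ) I γ s t :=
    MDifferentiableAt.comp_mdifferentiableWithinAt (g := fun Y : TangentBundle I N => Y.proj)
      (f := fun t => (⟨γ t, Z t⟩ : TangentBundle I N)) t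
      ((contMDiff_proj (n := ∞) (TangentSpace I)).mdifferentiable (by simp) _) hZ
  have h1 := hasDerivWithinAt_extChartAt_comp hZ (x₀ := (⟨γ t, Z t⟩ : TangentBundle I N))
    (mem_chart_source _ _)
  have h2 := hasDerivWithinAt_extChartAt_comp hγ (x₀ := γ t) (mem_chart_source _ _)
  rw [chartDeriv_self] at h1 h2
  let A : F × F := velocityAt I.tangent (fun t => (⟨γ t, Z t⟩ : TangentBundle I N)) s t
  have h3 : HasDerivWithinAt (fun r => (extChartAt I (γ t) (γ r), chartDeriv I (γ t) (γ r) (Z r)))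
    A s t := h1
  have h4 : HasDerivWithinAt (fun r => extChartAt I (γ t) (γ r)) A.1 s t := by
    simpa using h3.hasFDerivWithinAt.fst.hasDerivWithinAt
  have h5 : HasDerivWithinAt (fun r => chartDeriv I (γ t) (γ r) (Z r)) A.2 s t := by
    simpa using h3.hasFDerivWithinAt.snd.hasDerivWithinAt
  exact Prod.ext (UniqueDiffWithinAt.eq_deriv s hs h4 h2) (h5.derivWithin hs).symm

/-- The first component of the velocity of the field is the velocity of the base curve, and the flip
makes it the new base vector. -/
theorem canonicalFlip_velocity_proj (hs : UniqueDiffWithinAt ℝ s t)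
    (hZ : MDifferentiableWithinAt 𝓘(ℝ, ℝ) I.tangent
      (fun t => (⟨γ t, Z t⟩ : TangentBundle I N)) s t) :
    (canonicalFlip I (velocity I.tangent
      (fun r => (⟨γ r, Z r⟩ : TangentBundle I N)) s t)).proj = velocity I γ s t :=
  congrArg (fun A : F × F => (⟨γ t, A.1⟩ : TangentBundle I N)) (velocityAt_eq hs hZ)

variable [I.Boundaryless]

/-- `canonicalFlip` swaps components in the chart at the moving point `γ t`. The swap has the same
form in the fixed chart at `p` because the Hessian of the chart change is symmetric. -/
theorem chartDeriv_canonicalFlip_velocity (hs : UniqueDiffWithinAt ℝ s t)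
    (hZ : MDifferentiableWithinAt 𝓘(ℝ, ℝ) I.tangent
      (fun t => (⟨γ t, Z t⟩ : TangentBundle I N)) s t) (h : γ t ∈ (chartAt H p).source)
    (y₀ : TangentSpace I p) :
    chartDeriv I.tangent (⟨p, y₀⟩ : TangentBundle I N) (canonicalFlip I (velocity I.tangent
      (fun r => (⟨γ r, Z r⟩ : TangentBundle I N)) s t)).proj (canonicalFlip I (velocity I.tangent
      (fun r => (⟨γ r, Z r⟩ : TangentBundle I N)) s t)).snd =
    (chartDeriv I p (γ t) (Z t), derivWithin (fun r => chartDeriv I p (γ r) (Z r)) s t) := by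
  let A : F × F := velocityAt I.tangent (fun t => (⟨γ t, Z t⟩ : TangentBundle I N)) s t
  have h1 : HasDerivWithinAt (fun r => (extChartAt I p (γ r), chartDeriv I p (γ r) (Z r)))
      (chartDeriv I.tangent (⟨p, y₀⟩ : TangentBundle I N) (⟨γ t, Z t⟩ : TangentBundle I N) A : F × F)
      s t := hasDerivWithinAt_extChartAt_comp hZ (x₀ := (⟨p, y₀⟩ : TangentBundle I N))
        (by rw [TangentBundle.mem_chart_source_iff]; exact h)
  have h2 : (chartDeriv I.tangent (⟨p, y₀⟩ : TangentBundle I N)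
      (⟨γ t, Z t⟩ : TangentBundle I N) A : F × F) =
      (chartDeriv I p (γ t) A.1, transitionHess I p (γ t) A.1 (Z t) + chartDeriv I p (γ t) A.2) :=
    chartDeriv_tangent h y₀ (Z t) A.1 A.2
  rw [h2] at h1
  have h3 : HasDerivWithinAt (fun r => chartDeriv I p (γ r) (Z r))
      (transitionHess I p (γ t) A.1 (Z t) + chartDeriv I p (γ t) A.2) s t := by
    simpa using h1.hasFDerivWithinAt.snd.hasDerivWithinAt
  have h4 : transitionHess I p (γ t) A.1 (Z t) = transitionHess I p (γ t) (Z t) A.1 :=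
    transitionHess_symm h _ _
  rw [h3.derivWithin hs]
  exact (chartDeriv_tangent h y₀ A.1 (Z t) A.2).trans (congrArg
    (fun v : F => ((chartDeriv I p (γ t) (Z t), v + chartDeriv I p (γ t) A.2) : F × F)) h4.symm)

end Curves

/-! ### The Jacobi expression in components. -/

section Jacobi

theorem hasDerivWithinAt_clm_comp {F G : Type*} [NormedAddCommGroup F] [NormedSpace ℝ F]
    [NormedAddCommGroup G] [NormedSpace ℝ G]
    {Γ : F → F →L[ℝ] G} {DΓ : F →L[ℝ] F →L[ℝ] G} {x y : ℝ → F} {x' y' : F}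
    {s : Set ℝ} {t : ℝ} (hΓ : HasFDerivAt Γ DΓ (x t)) (hx : HasDerivWithinAt x x' s t)
    (hy : HasDerivWithinAt y y' s t) :
    HasDerivWithinAt (fun r => Γ (x r) (y r)) (DΓ x' (y t) + Γ (x t) y') s t :=
  (hΓ.comp_hasDerivWithinAt t hx).clm_apply hy

theorem hasDerivWithinAt_bilinear_comp {F : Type*} [NormedAddCommGroup F] [NormedSpace ℝ F]
    {Γ : F → F →L[ℝ] F →L[ℝ] F} {DΓ : F →L[ℝ] F →L[ℝ] F →L[ℝ] F} {x y v : ℝ → F} {x' y' v' : F}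
    {s : Set ℝ} {t : ℝ} (hΓ : HasFDerivAt Γ DΓ (x t)) (hx : HasDerivWithinAt x x' s t)
    (hy : HasDerivWithinAt y y' s t) (hv : HasDerivWithinAt v v' s t) :
    HasDerivWithinAt (fun r => Γ (x r) (y r) (v r))
      (DΓ x' (y t) (v t) + Γ (x t) y' (v t) + Γ (x t) (y t) v') s t :=
  (hasDerivWithinAt_clm_comp hΓ hx hy).clm_apply hv

variable {F : Type*} [NormedAddCommGroup F] [NormedSpace ℝ F] {H : Type*} [TopologicalSpace H]
  {I : ModelWithCorners ℝ F H} {N : Type*} [TopologicalSpace N] [ChartedSpace H N]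
  [IsManifold I ∞ N] {γ : ℝ → N} {s : Set ℝ} {t : ℝ} {p : N} {Z : Π t : ℝ, TangentSpace I (γ t)}

/-- Second derivatives at `t` require first-order formulas at all nearby parameters in one chart;
this packages what is needed there. -/
theorem eventually_hasDerivWithinAt_extChartAt_comp (hs : UniqueDiffOn ℝ s) (ht : t ∈ s)
    (hγ : ContMDiffOn 𝓘(ℝ, ℝ) I ∞ γ s) (h : γ t ∈ (chartAt H p).source) :
    ∀ᶠ r in 𝓝[s] t, r ∈ s ∧ (∀ᶠ r' in 𝓝[s] r, γ r' ∈ (chartAt H p).source) ∧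
      HasDerivWithinAt (fun r => extChartAt I p (γ r))
        (derivWithin (fun r => extChartAt I p (γ r)) s r) s r ∧
      chartDeriv I p (γ r) (velocityAt I γ s r) =
        derivWithin (fun r => extChartAt I p (γ r)) s r := by
  have h1 : ∀ᶠ r in 𝓝[s] t, γ r ∈ (chartAt H p).source :=
    (hγ t ht).continuousWithinAt ((chartAt H p).open_source.mem_nhds h)
  filter_upwards [eventually_mem_nhdsWithin, h1, eventually_eventually_nhdsWithin.2 h1]
    with r hr hr' hr''
  refine ⟨hr, hr'', ((contDiffWithinAt_extChartAt_comp (hγ r hr) hr').differentiableWithinAt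
    (by simp)).hasDerivWithinAt, ?_⟩
  exact (derivWithin_extChartAt_comp ((hγ r hr).mdifferentiableWithinAt (by simp)) (hs r hr)
    hr').symm

theorem eventually_hasDerivWithinAt_chartDeriv_comp (hs : UniqueDiffOn ℝ s) (ht : t ∈ s)
    (hγ : ContMDiffOn 𝓘(ℝ, ℝ) I ∞ γ s) (h : γ t ∈ (chartAt H p).source)
    (hZ : ContMDiffOn 𝓘(ℝ, ℝ) I.tangent ∞ (fun t => (⟨γ t, Z t⟩ : TangentBundle I N)) s) :
    ∀ᶠ r in 𝓝[s] t, HasDerivWithinAt (fun r => chartDeriv I p (γ r) (Z r))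
        (derivWithin (fun r => chartDeriv I p (γ r) (Z r)) s r) s r := by
  filter_upwards [eventually_hasDerivWithinAt_extChartAt_comp hs ht hγ h] with r hr
  exact ((contDiffWithinAt_chartDeriv_comp (hZ r hr.1)
    (hr.2.1.self_of_nhdsWithin hr.1)).differentiableWithinAt (by simp)).hasDerivWithinAt

variable [I.Boundaryless] [FiniteDimensional ℝ F]
  (cov : CovariantDerivative I F (TangentSpace I : N → Type _))

/-- The second covariant derivative in coordinates, from the first one. -/
theorem covAlong_eq_of_eventuallyEq (hs : UniqueDiffOn ℝ s) (ht : t ∈ s)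
    (hγ : ContMDiffOn 𝓘(ℝ, ℝ) I ∞ γ s) {W : Π t : ℝ, TangentSpace I (γ t)} {w : ℝ → F} {w' : F}
    (hw : (fun r => chartDeriv I (γ t) (γ r) (W r)) =ᶠ[𝓝[s] t] w)
    (hw' : HasDerivWithinAt w w' s t) :
    covAlong cov γ s W t = (w' + christoffel cov (γ t) (extChartAt I (γ t) (γ t)) (w t)
      (derivWithin (fun r => extChartAt I (γ t) (γ r)) s t) : F) := by
  have h := (eventually_hasDerivWithinAt_extChartAt_comp hs ht hγ
    (mem_chart_source H (γ t))).self_of_nhdsWithin ht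
  have h1 := chartDeriv_covAlong cov ht (hs t ht) h.2.1 h.2.2.1
    (hw'.congr_of_eventuallyEq hw (hw.self_of_nhdsWithin ht))
  have h2 : chartDeriv I (γ t) (γ t) (W t) = w t := hw.self_of_nhdsWithin ht
  rw [h2, chartDeriv_self] at h1
  exact h1

theorem covAlong_velocityAt_eq (hs : UniqueDiffOn ℝ s) (ht : t ∈ s)
    (hγ : ContMDiffOn 𝓘(ℝ, ℝ) I ∞ γ s) {x : ℝ → F} (hx : x = fun r => extChartAt I (γ t) (γ r)) :
    covAlong cov γ s (velocityAt I γ s) t = (derivWithin (derivWithin x s) s t +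
      christoffel cov (γ t) (x t) (derivWithin x s t) (derivWithin x s t) : F) := by
  subst hx
  refine covAlong_eq_of_eventuallyEq cov hs ht hγ ?_ (hasDerivWithinAt_derivWithin
    (contDiffWithinAt_extChartAt_comp (hγ t ht) (mem_chart_source H _)) hs ht)
  filter_upwards [eventually_hasDerivWithinAt_extChartAt_comp hs ht hγ
    (mem_chart_source H (γ t))] with r hr
  exact hr.2.2.2

variable [T2Space N] [cov.ContMDiffCovariantDerivative ∞] [CompleteSpace F]

/-- Torsion replaces `Γ(z)x'` by `Γ(x')z` under the outer derivative, and the curvature replaces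
`DΓ[x'](x')z` by `DΓ[z](x')x'`. The quadratic terms in `Γ` cancel except `Γ(Γ(x')x')z`, which joins
`Γ(x'')z` to form the geodesic expression. -/
theorem jacobi_eq (hs : UniqueDiffOn ℝ s) (ht : t ∈ s) (hγ : ContMDiffOn 𝓘(ℝ, ℝ) I ∞ γ s)
    (hZ : ContMDiffOn 𝓘(ℝ, ℝ) I.tangent ∞ (fun t => (⟨γ t, Z t⟩ : TangentBundle I N)) s)
    {x z x1 z1 : ℝ → F} {x2 z2 : F}
    (hx : x = fun r => extChartAt I (γ t) (γ r)) (hz : z = fun r => chartDeriv I (γ t) (γ r) (Z r))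
    (hx1 : x1 = derivWithin x s) (hz1 : z1 = derivWithin z s) (hx2 : x2 = derivWithin x1 s t)
    (hz2 : z2 = derivWithin z1 s t) {Γ : F → F →L[ℝ] F →L[ℝ] F}
    (hΓ : Γ = christoffel cov (γ t)) :
    covAlong cov γ s (covAlong cov γ s Z) t +
      covAlong cov γ s (fun r => cov.torsion (γ r) (Z r) (velocityAt I γ s r)) t +
      riemann cov (γ t) (Z t) (velocityAt I γ s t) (velocityAt I γ s t) =
    (fderiv ℝ Γ (x t) (z t) (x1 t) (x1 t) + Γ (x t) (x1 t) (z1 t) +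
      (z2 + Γ (x t) (z1 t) (x1 t)) + Γ (x t) (x2 + Γ (x t) (x1 t) (x1 t)) (z t) : F) := by
  have hp := mem_chart_source H (γ t)
  have hEx := eventually_hasDerivWithinAt_extChartAt_comp hs ht hγ hp
  have hEz := eventually_hasDerivWithinAt_chartDeriv_comp hs ht hγ hp hZ
  have hcx : ContDiffWithinAt ℝ ∞ x s t := hx ▸ contDiffWithinAt_extChartAt_comp (hγ t ht) hp
  have hcz : ContDiffWithinAt ℝ ∞ z s t := hz ▸ contDiffWithinAt_chartDeriv_comp (hZ t ht) hp
  have hdx1 := hasDerivWithinAt_derivWithin hcx hs ht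
  have hdz1 := hasDerivWithinAt_derivWithin hcz hs ht
  have hdx : HasDerivWithinAt x (x1 t) s t := by
    rw [hx1]; exact (hcx.differentiableWithinAt (by simp)).hasDerivWithinAt
  have hdz : HasDerivWithinAt z (z1 t) s t := by
    rw [hz1]; exact (hcz.differentiableWithinAt (by simp)).hasDerivWithinAt
  rw [← hx1, ← hx2] at hdx1
  rw [← hz1, ← hz2] at hdz1
  have hdΓ : HasFDerivAt Γ (fderiv ℝ Γ (x t)) (x t) := by
    rw [hΓ, hx]; exact (differentiableAt_christoffel cov (γ t)).hasFDerivAt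
  have e1 : (fun r => chartDeriv I (γ t) (γ r) (covAlong cov γ s Z r)) =ᶠ[𝓝[s] t]
      fun r => z1 r + Γ (x r) (z r) (x1 r) := by
    filter_upwards [hEx, hEz] with r hr hr'
    rw [chartDeriv_covAlong cov hr.1 (hs r hr.1) hr.2.1 hr.2.2.1 hr', hΓ, hz1, hx1, hx, hz]
  have e2 : (fun r => chartDeriv I (γ t) (γ r)
      (cov.torsion (γ r) (Z r) (velocityAt I γ s r))) =ᶠ[𝓝[s] t]
      fun r => Γ (x r) (x1 r) (z r) - Γ (x r) (z r) (x1 r) := by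
    filter_upwards [hEx] with r hr
    rw [chartDeriv_torsion cov (hr.2.1.self_of_nhdsWithin hr.1), hr.2.2.2, hΓ, hx1, hx, hz]
  have f1 := covAlong_eq_of_eventuallyEq cov hs ht hγ e1
    (hdz1.add (hasDerivWithinAt_bilinear_comp hdΓ hdx hdz hdx1))
  have f2 := covAlong_eq_of_eventuallyEq cov hs ht hγ e2
    ((hasDerivWithinAt_bilinear_comp hdΓ hdx hdx1 hdz).sub
      (hasDerivWithinAt_bilinear_comp hdΓ hdx hdz hdx1))
  have hZt : z t = Z t := by rw [hz]; exact chartDeriv_self _ _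
  have hvt : x1 t = velocityAt I γ s t := by
    rw [hx1, hx, ← (hEx.self_of_nhdsWithin ht).2.2.2]; exact chartDeriv_self _ _
  have hxt : x t = extChartAt I (γ t) (γ t) := by rw [hx]
  have hxt1 : derivWithin (fun r => extChartAt I (γ t) (γ r)) s t = x1 t := by rw [hx1, hx]
  rw [← hΓ, ← hxt, hxt1] at f1 f2
  have f3 : riemann cov (γ t) (Z t) (velocityAt I γ s t) (velocityAt I γ s t) =
      (fderiv ℝ Γ (x t) (z t) (x1 t) (x1 t) + Γ (x t) (Γ (x t) (x1 t) (x1 t)) (z t) -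
        (fderiv ℝ Γ (x t) (x1 t) (x1 t) (z t) + Γ (x t) (Γ (x t) (x1 t) (z t)) (x1 t)) : F) := by
    have h := riemann_eq cov (γ t) (Z t) (velocityAt I γ s t) (velocityAt I γ s t)
    rw [← hΓ, ← hxt] at h
    rw [hZt, hvt]
    exact h
  refine (congrArg₂ (fun a b : F => a + b) (congrArg₂ (fun a b : F => a + b) f1 f2) f3).trans ?_
  simp only [map_add, map_sub, _root_.add_apply, _root_.sub_apply]
  abel

end Jacobi

/-! ### The operator `D` on the flipped velocity, for the horizontal bundle. -/

section FlippedVelocity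

variable {F : Type*} [NormedAddCommGroup F] [NormedSpace ℝ F] {H : Type*} [TopologicalSpace H]
  {I : ModelWithCorners ℝ F H} {N : Type*} [TopologicalSpace N] [ChartedSpace H N]
  [IsManifold I ∞ N] [I.Boundaryless] [FiniteDimensional ℝ F] [T2Space N]
  (cov : CovariantDerivative I F (TangentSpace I : N → Type _)) [cov.ContMDiffCovariantDerivative ∞]
  {γ : ℝ → N} {s : Set ℝ} {t : ℝ} {Z : Π t : ℝ, TangentSpace I (γ t)}

/-- `IsSmoothComplement.operatorD_eq_zero_iff` on the tangent bundle with `α = connectorRep`: base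
path `(x, x1)` with velocity `(x1, x2)`, vector `(z, z1)` with derivative `(z1, z2)`. -/
theorem operatorD_canonicalFlip_eq_zero_iff (hs : UniqueDiffOn ℝ s) (ht : t ∈ s)
    (hγ : ContMDiffOn 𝓘(ℝ, ℝ) I ∞ γ s) (hgeo : covAlong cov γ s (velocityAt I γ s) t = 0)
    (hZ : ContMDiffOn 𝓘(ℝ, ℝ) I.tangent ∞ (fun t => (⟨γ t, Z t⟩ : TangentBundle I N)) s)
    {x z x1 z1 : ℝ → F} {x2 z2 : F}
    (hx : x = fun r => extChartAt I (γ t) (γ r)) (hz : z = fun r => chartDeriv I (γ t) (γ r) (Z r))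
    (hx1 : x1 = derivWithin x s) (hz1 : z1 = derivWithin z s) (hx2 : x2 = derivWithin x1 s t)
    (hz2 : z2 = derivWithin z1 s t) {Γ : F → F →L[ℝ] F →L[ℝ] F}
    (hΓ : Γ = christoffel cov (γ t))
    {X : ℝ → TangentBundle I.tangent (TangentBundle I N)}
    (hX : X = fun t => canonicalFlip I (velocity I.tangent
      (fun r => (⟨γ r, Z r⟩ : TangentBundle I N)) s t))
    {K : Π Y : TangentBundle I N, Submodule ℝ (TangentSpace I.tangent Y)}
    (hK : IsSmoothComplement I.tangent (horizontal cov) K) :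
    operatorD I.tangent hK X s t = 0 ↔
      fderiv ℝ Γ (x t) (z t) (x1 t) (x1 t) + Γ (x t) (x1 t) (z1 t) +
        (z2 + Γ (x t) (z1 t) (x1 t)) = 0 := by
  have hp := mem_chart_source H (γ t)
  have hEx := eventually_hasDerivWithinAt_extChartAt_comp hs ht hγ hp
  have hcx : ContDiffWithinAt ℝ ∞ x s t := hx ▸ contDiffWithinAt_extChartAt_comp (hγ t ht) hp
  have hcz : ContDiffWithinAt ℝ ∞ z s t := hz ▸ contDiffWithinAt_chartDeriv_comp (hZ t ht) hp
  have hdx1 := hasDerivWithinAt_derivWithin hcx hs ht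
  have hdz1 := hasDerivWithinAt_derivWithin hcz hs ht
  have hdx : HasDerivWithinAt x (x1 t) s t := by
    rw [hx1]; exact (hcx.differentiableWithinAt (by simp)).hasDerivWithinAt
  have hdz : HasDerivWithinAt z (z1 t) s t := by
    rw [hz1]; exact (hcz.differentiableWithinAt (by simp)).hasDerivWithinAt
  rw [← hx1, ← hx2] at hdx1
  rw [← hz1, ← hz2] at hdz1
  have hXp : ∀ r, (X r).proj.proj = γ r := fun r => by rw [hX]; rfl
  have e1 : (fun r => extChartAt I.tangent (X t).proj (X r).proj) =ᶠ[𝓝[s] t]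
      fun r => (x r, x1 r) := by
    filter_upwards [hEx] with r hr
    have h1 : (X r).proj = velocity I γ s r := by
      rw [hX]
      exact canonicalFlip_velocity_proj (hs r hr.1) ((hZ r hr.1).mdifferentiableWithinAt (by simp))
    rw [h1, extChartAt_tangent_apply, hXp, hx1, hx]
    exact Prod.ext rfl hr.2.2.2
  have e2 : (fun r => chartDeriv I.tangent (X t).proj (X r).proj (X r).snd) =ᶠ[𝓝[s] t]
      fun r => (z r, z1 r) := by
    filter_upwards [hEx] with r hr
    rw [hX, hz1, hz]
    exact chartDeriv_canonicalFlip_velocity (hs r hr.1)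
      ((hZ r hr.1).mdifferentiableWithinAt (by simp)) (hr.2.1.self_of_nhdsWithin hr.1) _
  have d1 := (hdx.prodMk hdx1).congr_of_eventuallyEq e1 (e1.self_of_nhdsWithin ht)
  have d2 := (hdz.prodMk hdz1).congr_of_eventuallyEq e2 (e2.self_of_nhdsWithin ht)
  have hXs : ∀ᶠ r in 𝓝[s] t, (X r).proj ∈ (chartAt (ModelProd H F) (X t).proj).source := by
    filter_upwards [hEx] with r hr
    rw [TangentBundle.mem_chart_source_iff, hXp, hXp]
    exact hr.2.1.self_of_nhdsWithin hr.1
  -- Differentiability of `X` comes from its coordinate expression `(x, x1; z, z1)`, so smoothness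
  -- of the involution is not needed.
  have hXd : MDifferentiableWithinAt 𝓘(ℝ, ℝ) I.tangent.tangent X s t := by
    refine mdifferentiableWithinAt_of_extChartAt_comp (x₀ := X t) ht ?_
      (d1.prodMk d2).differentiableWithinAt
    filter_upwards [hXs] with r hr
    rw [TangentBundle.mem_chart_source_iff]
    exact hr
  have hβd : MDifferentiableWithinAt 𝓘(ℝ, ℝ) I.tangent (fun r => (X r).proj) s t :=
    mdifferentiableWithinAt_of_extChartAt_comp (x₀ := (X t).proj) ht hXs d1.differentiableWithinAt
  have hv : velocityAt I.tangent (fun r => (X r).proj) s t = ((x1 t, x2) : F × F) := by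
    have h := UniqueDiffWithinAt.eq_deriv s (hs t ht)
      (hasDerivWithinAt_extChartAt_comp (x₀ := (X t).proj) hβd (mem_chart_source _ _)) d1
    rwa [chartDeriv_self] at h
  have hXt : (X t).snd = ((z t, z1 t) : F × F) :=
    (chartDeriv_self (I := I.tangent) (X t).proj (X t).snd).symm.trans (e2.self_of_nhdsWithin ht)
  have hpt : extChartAt I.tangent (X t).proj (X t).proj = (x t, x1 t) := e1.self_of_nhdsWithin ht
  have hxt : x t = extChartAt I (γ t) (γ t) := by rw [hx]
  obtain ⟨L, hL, hL'⟩ := hasFDerivAt_connectorRep cov (differentiableAt_christoffel cov (γ t)) (x1 t)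
  rw [← hxt, ← hΓ] at hL'
  rw [← hxt, ← hpt] at hL
  have hα (b c : F) : connectorRep cov (γ t) (x t, x1 t) (b, c) = c + Γ (x t) (x1 t) b := by
    rw [hΓ]; rfl
  have hS : ∀ᶠ Y in 𝓝 (X t).proj, ∀ A : TangentSpace I.tangent Y, A ∈ horizontal cov Y ↔
      connectorRep cov (γ t) (extChartAt I.tangent (X t).proj Y)
        (chartDeriv I.tangent (X t).proj Y A) = 0 := by
    filter_upwards [(chartAt (ModelProd H F) (X t).proj).open_source.mem_nhds
      (mem_chart_source _ _)] with Y hY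
    rw [TangentBundle.mem_chart_source_iff] at hY
    subst hX
    exact mem_horizontal_iff cov hY _
  -- In components, horizontality of the velocity `(x1, x2)` at `(x, x1)` is the geodesic equation
  -- `x2 + Γ(x1)x1 = 0`.
  have hβ : velocityAt I.tangent (fun r => (X r).proj) s t ∈ horizontal cov (X t).proj := by
    rw [hS.self_of_nhds, chartDeriv_self, hpt, hv, hα]
    rw [hx2, hx1, hΓ]
    exact (covAlong_velocityAt_eq cov hs ht hγ hx).symm.trans hgeo
  rw [hK.operatorD_eq_zero_iff (hs t ht) hXd hL.differentiableAt hS hβ d2, hXt, hv, hL.fderiv,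
    hL', hpt, hα]
  exact Eq.congr (by abel) rfl

end FlippedVelocity
end TangentPaths

/-! ### The equivalence. -/

theorem theorem13 {E : Type*} [NormedAddCommGroup E] [NormedSpace ℝ E] [FiniteDimensional ℝ E]
    [CompleteSpace E] {M : Type*} [TopologicalSpace M] [T2Space M] [ChartedSpace E M]
    [IsManifold 𝓘(ℝ, E) ∞ M]
    (cov : CovariantDerivative 𝓘(ℝ, E) E (TangentSpace 𝓘(ℝ, E) : M → Type _))
    [cov.ContMDiffCovariantDerivative ∞]
    (s : Set ℝ) (hs : s.OrdConnected) (hs' : s.Nontrivial)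
    (γ₀ : ℝ → M) (hγ₀ : TangentPaths.IsGeodesicOn cov γ₀ s)
    (Z : Π t : ℝ, TangentSpace 𝓘(ℝ, E) (γ₀ t))
    (hZ : ContMDiffOn 𝓘(ℝ, ℝ) 𝓘(ℝ, E).tangent ∞
      (fun t => (⟨γ₀ t, Z t⟩ : TangentBundle 𝓘(ℝ, E) M)) s)
    (β₀ : ℝ → TangentBundle 𝓘(ℝ, E) M) (hβ₀ : ∀ t, β₀ t = TangentPaths.velocity 𝓘(ℝ, E) γ₀ s t)
    (X : ℝ → TangentBundle 𝓘(ℝ, E).tangent (TangentBundle 𝓘(ℝ, E) M))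
    (hX : ∀ t, X t = TangentPaths.canonicalFlip 𝓘(ℝ, E) (TangentPaths.velocity 𝓘(ℝ, E).tangent
      (fun r => (⟨γ₀ r, Z r⟩ : TangentBundle 𝓘(ℝ, E) M)) s t)) :
    (∀ t ∈ s, (X t).proj = β₀ t) ∧
    (∀ t ∈ s, TangentPaths.velocityAt 𝓘(ℝ, E).tangent β₀ s t ∈
      TangentPaths.horizontal cov (β₀ t)) ∧
    ∀ (K : Π Y : TangentBundle 𝓘(ℝ, E) M, Submodule ℝ (TangentSpace 𝓘(ℝ, E).tangent Y))
      (hK : TangentPaths.IsSmoothComplement 𝓘(ℝ, E).tangent (TangentPaths.horizontal cov) K),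
      TangentPaths.IsJacobiOn cov γ₀ s Z ↔
        ∀ t ∈ s, TangentPaths.operatorD 𝓘(ℝ, E).tangent hK X s t = 0 := by
  obtain rfl : β₀ = TangentPaths.velocity 𝓘(ℝ, E) γ₀ s := funext hβ₀
  have hs'' : UniqueDiffOn ℝ s :=
    uniqueDiffOn_convex hs.convex (hs.convex.nontrivial_iff_nonempty_interior.1 hs')
  have hZ' := hZ.mdifferentiableOn (by simp)
  -- `hγ₀.2` settles horizontality as it stands: the geodesic equation says that the vertical
  -- projection kills the velocity of the velocity curve.
  refine ⟨fun t ht => ?_, hγ₀.2, fun K hK => forall₂_congr fun t ht => ?_⟩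
  · rw [hX]
    exact TangentPaths.canonicalFlip_velocity_proj (hs'' t ht) (hZ' t ht)
  · have h1 := TangentPaths.jacobi_eq cov hs'' ht hγ₀.1 hZ rfl rfl rfl rfl rfl rfl rfl
    have h2 := TangentPaths.covAlong_velocityAt_eq cov hs'' ht hγ₀.1 rfl
    have h3 := TangentPaths.operatorD_canonicalFlip_eq_zero_iff cov hs'' ht hγ₀.1 (hγ₀.2 t ht) hZ
      rfl rfl rfl rfl rfl rfl rfl (funext hX) hK
    rw [hγ₀.2 t ht] at h2
    rw [h3, h1, ← h2]
    -- With the geodesic equation inserted, the surplus term of `jacobi_eq` is `Γ` applied to zero.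
    have h4 (v : E) : TangentPaths.christoffel cov (γ₀ t) (extChartAt 𝓘(ℝ, E) (γ₀ t) (γ₀ t))
        (0 : E) v = 0 := by
      rw [map_zero, _root_.zero_apply]
    exact Eq.congr ((congrArg (_ + ·) (h4 _)).trans (add_zero _)) rfl
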